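/- Let $\mathbb K$ be an algebraically closed field and let $X=\operatorname{Spec}A$ be an affine variety over $\mathbb K$, i.e. $A$ is a finitely generated $\mathbb K$-algebra which is an integral domain. **Definitions.** A *degree like function* on $A$ is a map $\delta:A\setminus\{0\}\to\mathbb Z$ (with the convention $\delta(0)=-\infty$) such that $\delta(c)\le 0$ for $c\in\mathbb K$; $\delta(f+g)\le\max\{\delta(f),\delta(g)\}$, with strict inequality only if $\delta(f)=\delta(g)$; and $\delta(fg)\le\delta(f)+\delta(g)$. It is a *semidegree* if $\delta(fg)=\delta(f)+\delta(g)$ for all $f,g$, and a *quasidegree* if $\delta=\max_{1\le i\le N}\delta_i$ for finitely many (at least one) semidegrees $\delta_1,\dots,\delta_N$. Put $F_d=\{f\in A:\delta(f)\le d\}$ for $d \in \mathbb Z$. The function $\delta$ is *complete* if $F_d=0$ for $d<0$, $F_0=\mathbb K$, and the graded ring $A^\delta=\bigoplus_{d\ge 0}F_d$ is a finitely generated $\mathbb K$-algebra. Write $(f)_d$ for $f\in F_d$ regarded as an element of degree $d$ of $A^\delta$. Then $\psi_\delta:X\to X^\delta:=\operatorname{Proj}A^\delta$ denotes the natural morphism,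 $\mathfrak p\mapsto\bigoplus_d(\mathfrak p\cap F_d)$, which identifies $X$ with the basic open subset $\{(1)_1\neq 0\}$ of $X^\delta$. For subsets $V_1,\dots,V_m$ of $X$, the map $\psi_\delta$ *preserves the intersection of $V_1,\dots,V_m$ at $\infty$* if $\overline V_1\cap\dots\cap\overline V_m\cap (X^\delta\setminus \psi_\delta(X))=\emptyset$, where $\overline V_j$ is the closure of $\psi_\delta(V_j)$ in $X^\delta$. For a morphism $f=(f_1,\dots,f_r):X\to Y\subseteq\mathbb K^r$, $\psi_\delta$ *preserves $f$ at $\infty$* if there is a non-empty Zariski open subset $U$ of $f(X)\subseteq\mathbb K^r$ (the image of the set of $\mathbb K$-points of $X$) such that for every $a\in U$ the map $\psi_\delta$ preserves at $\infty$ the intersection of the sets $H_i(a)=\{x\in X: f_i(x)=a_i\}$, $i=1,\dots,r$. **Statement.** 1. Let $V_1,\dots,V_m$ be closed subsets of $X$ such that $\bigcap_iV_i$ is a finite set. Then there is a complete quasidegree $\delta$ on $A$ such that $\psi_\delta$ is an open immersion with dense image and $\psi_\delta$ preserves the intersection of $V_1,\dots,V_m$ at $\infty$. 2. Let $Y\subseteq\mathbb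 K^r$ be an affine variety (an irreducible closed subvariety of $\mathbb K^r$) with $\dim Y=\dim X$ and let $f=(f_1,\dots,f_r):X\to Y$ be a dominant morphism. Then there is a complete quasidegree $\delta$ on $A$ such that $\psi_\delta$ is an open immersion with dense image and $\psi_\delta$ preserves $f$ at $\infty$. -/

import Mathlib

open CategoryTheory AlgebraicGeometry

universe u v w

/-- An integer valued degree like function on a `K`-algebra `A`: a map `A \ {0} → ℤ`, extended by
the value `-∞` at `0`. -/
structure DegreeLike (K A : Type*) [Field K] [CommRing A] [Algebra K A] where
  toFun : A → WithBot ℤ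
  eq_bot_iff' : ∀ f, toFun f = ⊥ ↔ f = 0
  const_le' : ∀ c : K, toFun (algebraMap K A c) ≤ 0
  add_le' : ∀ f g, toFun (f + g) ≤ max (toFun f) (toFun g)
  eq_of_add_lt' : ∀ f g, toFun (f + g) < max (toFun f) (toFun g) → toFun f = toFun g
  mul_le' : ∀ f g, toFun (f * g) ≤ toFun f + toFun g

namespace DegreeLike

variable {K A : Type*} [Field K] [CommRing A] [Algebra K A]

instance : CoeFun (DegreeLike K A) (fun _ => A → WithBot ℤ) := ⟨DegreeLike.toFun⟩

/-- A semidegree is a degree like function that sends products to sums. -/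
def IsSemidegree (δ : DegreeLike K A) : Prop :=
  ∀ f g : A, δ (f * g) = δ f + δ g

/-- A quasidegree is the maximum of finitely many (at least one) semidegrees. -/
def IsQuasidegree (δ : DegreeLike K A) : Prop :=
  ∃ (N : ℕ) (s : Fin N → DegreeLike K A), 1 ≤ N ∧ (∀ i, (s i).IsSemidegree) ∧
    ∀ f : A, δ f = Finset.univ.sup (fun i => s i f)

/-- The filtration of a degree like function, `F_d = {f : δ f ≤ d}`. -/
def filtration (δ : DegreeLike K A) (d : ℤ) : Submodule K A where
  carrier := {f | δ f ≤ (d : WithBot ℤ)}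
  zero_mem' := by
    have h : δ (0 : A) = ⊥ := (δ.eq_bot_iff' 0).2 rfl
    simp [h]
  add_mem' {f g} hf hg := (δ.add_le' f g).trans (max_le hf hg)
  smul_mem' c f hf := by
    have h : δ (c • f) ≤ δ (algebraMap K A c) + δ f := by
      rw [Algebra.smul_def]
      exact δ.mul_le' _ _
    exact h.trans (by simpa using add_le_add (δ.const_le' c) hf)

theorem mem_filtration {δ : DegreeLike K A} {d : ℤ} {f : A} :
    f ∈ δ.filtration d ↔ δ f ≤ (d : WithBot ℤ) := Iff.rfl

theorem filtration_mono (δ : DegreeLike K A) {d e : ℤ} (h : d ≤ e) :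
    δ.filtration d ≤ δ.filtration e :=
  fun _ hf => le_trans hf (WithBot.coe_le_coe.2 h)

theorem one_mem_filtration_zero (δ : DegreeLike K A) : (1 : A) ∈ δ.filtration 0 := by
  have h := δ.const_le' 1
  rw [map_one] at h
  exact h

theorem mul_mem_filtration (δ : DegreeLike K A) {d e : ℤ} {f g : A}
    (hf : f ∈ δ.filtration d) (hg : g ∈ δ.filtration e) : f * g ∈ δ.filtration (d + e) := by
  refine (δ.mul_le' f g).trans ?_
  rw [WithBot.coe_add]
  exact add_le_add hf hg

/-- The graded ring `A^δ = ⨁_{d ≥ 0} F_d` of a non-negative `δ`, realised as the subring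
`∑_d F_d t^d` of `A[t]`; the element `(f)_d` is `f t^d`. (For non-negative `δ` the pieces of
negative degree are zero; only this case is used.) -/
def gradedRing (δ : DegreeLike K A) : Subalgebra K (Polynomial A) where
  carrier := {p | ∀ i : ℕ, p.coeff i ∈ δ.filtration i}
  mul_mem' {p q} hp hq i := by
    rw [Polynomial.coeff_mul]
    refine Submodule.sum_mem _ fun x hx => ?_
    have h := δ.mul_mem_filtration (hp x.1) (hq x.2)
    rw [← Finset.HasAntidiagonal.mem_antidiagonal.1 hx]
    exact_mod_cast h
  add_mem' {p q} hp hq i := by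
    rw [Polynomial.coeff_add]
    exact Submodule.add_mem _ (hp i) (hq i)
  algebraMap_mem' c i := by
    rw [IsScalarTower.algebraMap_apply K A (Polynomial A), Polynomial.algebraMap_eq,
      Polynomial.coeff_C]
    split_ifs with h
    · subst h
      exact δ.const_le' c
    · exact Submodule.zero_mem _

theorem mem_gradedRing {δ : DegreeLike K A} {p : Polynomial A} :
    p ∈ δ.gradedRing ↔ ∀ i : ℕ, p.coeff i ∈ δ.filtration i := Iff.rfl

theorem monomial_mem_gradedRing (δ : DegreeLike K A) (d : ℕ) {f : A} (hf : f ∈ δ.filtration d) :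
    Polynomial.monomial d f ∈ δ.gradedRing := by
  intro i
  rw [Polynomial.coeff_monomial]
  split_ifs with h
  · subst h
    exact hf
  · exact Submodule.zero_mem _

/-- The homogeneous elements of degree `d` of `A^δ`: those of the form `(f)_d = f t^d`. -/
def grading (δ : DegreeLike K A) (d : ℕ) : Submodule K δ.gradedRing where
  carrier := {p | ∀ i : ℕ, i ≠ d → (p : Polynomial A).coeff i = 0}
  zero_mem' i _ := by simp
  add_mem' {p q} hp hq i hi := by simp [hp i hi, hq i hi]
  smul_mem' c p hp i hi := by simp [hp i hi]

/-- The homogeneous element `(f)_d = f t^d` for `f ∈ F_d`. -/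
noncomputable def homog (δ : DegreeLike K A) (d : ℕ) (f : A) (hf : f ∈ δ.filtration d) :
    δ.gradedRing :=
  ⟨Polynomial.monomial d f, δ.monomial_mem_gradedRing d hf⟩

theorem homog_mem_grading (δ : DegreeLike K A) (d : ℕ) (f : A) (hf : f ∈ δ.filtration d) :
    δ.homog d f hf ∈ δ.grading d := by
  intro i hi
  change (Polynomial.monomial d f).coeff i = 0
  rw [Polynomial.coeff_monomial, if_neg hi.symm]

instance gradedMonoid (δ : DegreeLike K A) : SetLike.GradedMonoid δ.grading where
  one_mem i hi := by
    change (1 : Polynomial A).coeff i = 0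
    rw [Polynomial.coeff_one, if_neg hi]
  mul_mem d e p q hp hq i hi := by
    change ((p : Polynomial A) * (q : Polynomial A)).coeff i = 0
    rw [Polynomial.coeff_mul]
    refine Finset.sum_eq_zero fun x hx => ?_
    by_cases h1 : x.1 = d
    · have h2 : x.2 ≠ e := by
        intro h2
        exact hi (by rw [← Finset.HasAntidiagonal.mem_antidiagonal.1 hx, h1, h2])
      rw [hq _ h2, mul_zero]
    · rw [hp _ h1, zero_mul]

/-- The homogeneous component of degree `d` of an element of `A^δ`. -/
noncomputable def component (δ : DegreeLike K A) (d : ℕ) (p : δ.gradedRing) : δ.grading d :=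
  ⟨δ.homog d ((p : Polynomial A).coeff d) (p.2 d), δ.homog_mem_grading d _ _⟩

theorem component_add (δ : DegreeLike K A) (d : ℕ) (p q : δ.gradedRing) :
    δ.component d (p + q) = δ.component d p + δ.component d q := by
  apply Subtype.ext
  apply Subtype.ext
  change Polynomial.monomial d (((p : Polynomial A) + (q : Polynomial A)).coeff d) =
    Polynomial.monomial d ((p : Polynomial A).coeff d) +
      Polynomial.monomial d ((q : Polynomial A).coeff d)
  rw [Polynomial.coeff_add, map_add]

theorem component_eq_zero (δ : DegreeLike K A) (d : ℕ) (p : δ.gradedRing)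
    (h : (p : Polynomial A).coeff d = 0) : δ.component d p = 0 := by
  apply Subtype.ext
  apply Subtype.ext
  change Polynomial.monomial d ((p : Polynomial A).coeff d) = 0
  rw [h, map_zero]

theorem component_self (δ : DegreeLike K A) {d : ℕ} (p : δ.grading d) :
    δ.component d (p : δ.gradedRing) = p := by
  apply Subtype.ext
  apply Subtype.ext
  change Polynomial.monomial d (((p : δ.gradedRing) : Polynomial A).coeff d) = _
  ext i
  rw [Polynomial.coeff_monomial]
  split_ifs with hi
  · subst hi
    rfl
  · exact (p.2 i (Ne.symm hi)).symm

theorem component_coe (δ : DegreeLike K A) (d : ℕ) (x : DirectSum ℕ fun i => δ.grading i) :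
    δ.component d (DirectSum.coeAddMonoidHom δ.grading x) = x d := by
  induction x using DirectSum.induction_on with
  | zero =>
    rw [map_zero]
    exact δ.component_eq_zero d 0 (by simp)
  | of i p =>
    rw [DirectSum.coeAddMonoidHom_of]
    by_cases h : i = d
    · subst h
      rw [component_self, DirectSum.of_eq_same]
    · rw [DirectSum.of_eq_of_ne _ _ _ (Ne.symm h)]
      exact δ.component_eq_zero d _ (p.2 d (Ne.symm h))
  | add x y hx hy => rw [map_add, component_add, hx, hy, DirectSum.add_apply]

theorem ext_component (δ : DegreeLike K A) {p q : δ.gradedRing}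
    (h : ∀ d, δ.component d p = δ.component d q) : p = q := by
  apply Subtype.ext
  ext d
  have h1 : Polynomial.monomial d ((p : Polynomial A).coeff d) =
      Polynomial.monomial d ((q : Polynomial A).coeff d) :=
    congrArg (fun x : δ.grading d => ((x : δ.gradedRing) : Polynomial A)) (h d)
  exact Polynomial.monomial_injective d h1

/-- The decomposition of an element of `A^δ` as the finite sum of its components. -/
noncomputable def decompose (δ : DegreeLike K A) (p : δ.gradedRing) :
    DirectSum ℕ fun i => δ.grading i :=
  DirectSum.mk (fun d => δ.grading d) (p : Polynomial A).support (fun d => δ.component d p)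

theorem decompose_apply (δ : DegreeLike K A) (p : δ.gradedRing) (d : ℕ) :
    δ.decompose p d = δ.component d p := by
  by_cases h : d ∈ (p : Polynomial A).support
  · exact DirectSum.mk_apply_of_mem h
  · rw [component_eq_zero δ d p (Polynomial.notMem_support_iff.1 h)]
    exact DirectSum.mk_apply_of_notMem h

noncomputable instance decomposition (δ : DegreeLike K A) :
    DirectSum.Decomposition δ.grading where
  decompose' := δ.decompose
  left_inv p := δ.ext_component fun d => by rw [component_coe, decompose_apply]
  right_inv x := DFinsupp.ext fun d => by
    exact (δ.decompose_apply _ d).trans (δ.component_coe d x)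

noncomputable instance gradedAlgebra (δ : DegreeLike K A) : GradedAlgebra δ.grading where

/-- A degree like function is complete if its filtration is non-negative and finitely generated
(that is, `A^δ` is a finitely generated `K`-algebra) and `F_0 = K`. -/
structure IsComplete (δ : DegreeLike K A) : Prop where
  nonneg : ∀ d : ℤ, d < 0 → δ.filtration d = ⊥
  finitelyGenerated : Algebra.FiniteType K δ.gradedRing
  filtration_zero : δ.filtration 0 = LinearMap.range (Algebra.linearMap K A)

/-- The element `t = (1)_1` of `A^δ`. -/
noncomputable def t (δ : DegreeLike K A) : δ.gradedRing :=
  δ.homog 1 1 (δ.filtration_mono (by simp) δ.one_mem_filtration_zero)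

theorem t_mem_grading (δ : DegreeLike K A) : δ.t ∈ δ.grading 1 :=
  δ.homog_mem_grading 1 1 _

/-- The ring homomorphism `A^δ → A`, `(f)_d ↦ f`. -/
noncomputable def forget (δ : DegreeLike K A) : δ.gradedRing →+* A :=
  (Polynomial.evalRingHom (1 : A)).comp δ.gradedRing.val.toRingHom

theorem forget_homog (δ : DegreeLike K A) (d : ℕ) (f : A) (hf : f ∈ δ.filtration d) :
    δ.forget (δ.homog d f hf) = f := by
  change (Polynomial.monomial d f).eval 1 = f
  simp

theorem isUnit_forget_t (δ : DegreeLike K A) : IsUnit (δ.forget δ.t) := by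
  rw [t, forget_homog]
  exact isUnit_one

/-- The homomorphism from the degree zero part of the localization of `A^δ` at `t` to `A`,
`(f)_d / t^d ↦ f`. -/
noncomputable def dehomogenize (δ : DegreeLike K A) :
    HomogeneousLocalization.Away δ.grading δ.t →+* A :=
  (Localization.awayLift δ.forget δ.t δ.isUnit_forget_t).comp
    (algebraMap (HomogeneousLocalization.Away δ.grading δ.t) (Localization.Away δ.t))

end DegreeLike

/-- The natural map `ψ_δ : X = Spec A → X^δ = Proj A^δ`, which identifies `X` with the basic open
set `D₊(t) = Spec ((A^δ)_t)₀`; on points it sends `p` to `⨁_d (p ∩ F_d)`. -/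
noncomputable def DegreeLike.completion {K : Type w} {A : Type u} [Field K] [CommRing A]
    [Algebra K A] (δ : DegreeLike K A) : Spec (CommRingCat.of A) ⟶ Proj δ.grading :=
  Spec.map (CommRingCat.ofHom δ.dehomogenize) ≫
    Proj.awayι δ.grading δ.t δ.t_mem_grading Nat.one_pos

/-- `ψ : X → Z` preserves the intersection of the subsets `V i` of `X` at infinity: the closures
of the `V i` in `Z` have no common point in `X_∞ = Z \ X`. -/
def PreservesIntersectionAtInfinity {X Z : Scheme.{u}} (ψ : X ⟶ Z) {ι : Type*} (V : ι → Set X) :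
    Prop :=
  (⋂ i, closure (ψ '' V i)) ∩ (Set.range ψ)ᶜ = ∅

/-- The closed subset `{x ∈ X : f(x) = c}` of `X = Spec A`. -/
def levelSet {K : Type w} {A : Type u} [Field K] [CommRing A] [Algebra K A] (f : A) (c : K) :
    Set (Spec (CommRingCat.of A)) :=
  PrimeSpectrum.zeroLocus {f - algebraMap K A c}

/-- The image in `K^r` of the set of `K`-points of `X = Spec A` under `(f_1, …, f_r)`. -/
def pointImage (K : Type w) {A : Type u} [Field K] [CommRing A] [Algebra K A] {r : ℕ}
    (f : Fin r → A) : Set (Fin r → K) :=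
  Set.range fun (x : A →ₐ[K] K) (i : Fin r) => x (f i)

/-- `ψ` preserves `f = (f_1, …, f_r) : X → K^r` at infinity: for all `a` in some non-empty Zariski
open subset of `f(X)`, it preserves at infinity the intersection of the hypersurfaces
`H_i(a) = {x ∈ X : f_i(x) = a_i}`. -/
def PreservesMapAtInfinity (K : Type w) {A : Type u} [Field K] [CommRing A] [Algebra K A]
    {Z : Scheme.{u}} (ψ : Spec (CommRingCat.of A) ⟶ Z) {r : ℕ} (f : Fin r → A) : Prop :=
  ∃ I : Ideal (MvPolynomial (Fin r) K),
    (pointImage K f \ MvPolynomial.zeroLocus K I).Nonempty ∧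
    ∀ a ∈ pointImage K f \ MvPolynomial.zeroLocus K I,
      PreservesIntersectionAtInfinity ψ (fun i => levelSet (f i) (a i))

/-!
A complete quasidegree is built from a finite-dimensional subspace `W` generating `A`, and both
statements are then reduced to linear algebra in `W`.

*Construction.* By a linear version of Noether normalization, there are algebraically independent
`y₁, …, yₙ ∈ W` such that, in `A[s]`, every `s w` with `w ∈ W` is integral over
`K[s, s y₁, …, s yₙ]` (`exists_algebraicIndependent_isIntegral_reesAdjoin`). Give the `yᵢ` a large
weight `e` and let `F_d` consist of the `f` such that `s^d f` is integral over
`K[s, s^e y₁, …, s^e yₙ]` (`integralFiltration`). Then `F_0 = K`, as is seen by setting `s = 0`, and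
`A^δ` is the integral closure of the polynomial ring `K[s, s^e y₁, …, s^e yₙ]` in `A[s]`. It is a
finite module (`finite_integralClosure_of_isAlgebraic`, where a power of Frobenius takes care of
inseparability), hence a finitely generated algebra.

The degree of `f` is governed by the Newton slope of its minimal polynomial over `K[y₁, …, yₙ]`:
weighted degrees are additive, so a monic factor of a monic polynomial of small slope has small
slope (`HasSlopeLE.of_mul`, the Gauss lemma for the absolute value `2^deg`). If the degrees of
minimal polynomials are at most `M`, then `e = M!` clears the denominators of all slopes. Therefore `f^k ∈ F_{kd-1}` implies `f ∈ F_{d-1}` (`mem_integralFiltration_of_pow_mem_of_lt`), that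
is, the element `t = (1)_1` generates a radical ideal of `A^δ`. A local ring of `A^δ` at a minimal
prime of `(t)` then has its maximal ideal generated by `t`, and `δ` is the maximum of the orders of
pole along these finitely many primes, which are semidegrees
(`DegreeLike.isQuasidegree_of_isRadical`).

*Points at infinity.* Such a point is a relevant homogeneous prime `P ∋ t`. Let `V ⊆ W` be the
subspace of those `w` whose class `(w)_e` lies in `P`. Since `A^δ` is integral over
`K[s, s^e y₁, …, s^e yₙ]`, the equality `V = W` is impossible
(`DegreeLike.irrelevant_le_of_mem_vanishingPart`). If `P` is in the closure of the zero locus of an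
ideal `I`, then `W ∩ I ⊆ V`; and `x^l, x^k ∈ W` with `l < k` forces `x^l ∈ V`, because
`(x^l)^k = (x^k)^l 1^{k-l}` and `(1)_e = t^e ∈ P`. So it is enough to choose `W` for which these
facts force `V = W` (`exists_completion_preservesIntersectionAtInfinity`).

*Finite intersections.* If the intersection of the zero loci of the `Iᵢ` is finite, each generator
`x` of `A` satisfies `p(x) = ∑ᵢ fᵢ` with `p` a monic polynomial over `K` of degree `k` and
`fᵢ ∈ Iᵢ`. Let `W` be spanned by the `x^l` with `l ≤ k` and the `fᵢ`. Then `fᵢ ∈ V`, and `x^l ∈ V`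
for `l < k`, so the relation gives `x^k ∈ V`.

*Dominant morphisms.* Equality of dimensions makes `A` algebraic over `B = K[f₁, …, f_r]`; let `p`
be an equation of the generator `x` over `B`. Let `W` be spanned by the products of the `x^l`,
`l ≤ deg p`, with the polynomials of degree at most `D` in the `fᵢ`, where `D` is large enough to
allow for the coefficients of `p`. The ideals `Iᵢ = (fᵢ - aᵢ)` allow these coefficients to be
replaced by their values at `a` modulo `V`, and the previous argument applies wherever the leading
coefficients do not vanish.
-/

/-! ### The completion of `Spec A` attached to a degree like function -/

namespace DegreeLike

section Completion

variable {K : Type w} {A : Type u} [Field K] [CommRing A] [Algebra K A] (δ : DegreeLike K A)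

theorem exists_mem_filtration (f : A) : ∃ d : ℕ, f ∈ δ.filtration d := by
  rcases h : δ f with _ | n
  · exact ⟨0, by rw [mem_filtration, h]; exact bot_le⟩
  · refine ⟨n.toNat, ?_⟩
    rw [mem_filtration, h]
    exact WithBot.coe_le_coe.2 (Int.self_le_toNat n)

theorem dehomogenize_mk (n : ℕ) (x : δ.gradedRing) (hx : x ∈ δ.grading (n • 1)) :
    δ.dehomogenize (HomogeneousLocalization.Away.mk δ.grading δ.t_mem_grading n x hx) =
      δ.forget x := by
  have ht : δ.forget δ.t = 1 := by rw [t, forget_homog]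
  change Localization.awayLift δ.forget δ.t δ.isUnit_forget_t
    (HomogeneousLocalization.Away.mk δ.grading δ.t_mem_grading n x hx).val = _
  rw [HomogeneousLocalization.Away.val_mk, Localization.awayLift_mk (v := 1) (hv := by simp [ht])]
  simp

theorem eq_homog_of_mem_grading {d : ℕ} {x : δ.gradedRing} (hx : x ∈ δ.grading d) :
    x = δ.homog d ((x : Polynomial A).coeff d) (x.2 d) :=
  (congrArg Subtype.val (δ.component_self ⟨x, hx⟩)).symm

theorem homog_zero (d : ℕ) (h : (0 : A) ∈ δ.filtration d) : δ.homog d 0 h = 0 :=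
  Subtype.ext (map_zero (Polynomial.monomial d))

theorem homog_add {d : ℕ} {f g : A} (hf : f ∈ δ.filtration d) (hg : g ∈ δ.filtration d) :
    δ.homog d (f + g) (add_mem hf hg) = δ.homog d f hf + δ.homog d g hg :=
  Subtype.ext (map_add (Polynomial.monomial d) f g)

theorem homog_mul {d e : ℕ} {f g : A} (hf : f ∈ δ.filtration d) (hg : g ∈ δ.filtration e)
    (h : f * g ∈ δ.filtration (d + e : ℕ)) :
    δ.homog (d + e) (f * g) h = δ.homog d f hf * δ.homog e g hg :=
  Subtype.ext (Polynomial.monomial_mul_monomial d e f g).symm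

theorem homog_smul {d : ℕ} {f : A} (c : K) (hf : f ∈ δ.filtration d) :
    δ.homog d (c • f) (Submodule.smul_mem _ c hf) = c • δ.homog d f hf :=
  Subtype.ext (Polynomial.smul_monomial c d f).symm

theorem forget_eq_zero_of_mem_grading {d : ℕ} {x : δ.gradedRing} (hx : x ∈ δ.grading d)
    (h : δ.forget x = 0) : x = 0 := by
  have h1 := δ.eq_homog_of_mem_grading hx
  rw [h1, forget_homog] at h
  rw [h1]
  simp only [h, homog_zero]

theorem dehomogenize_bijective : Function.Bijective δ.dehomogenize := by
  constructor
  · rw [injective_iff_map_eq_zero]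
    intro z hz
    obtain ⟨n, x, hx, rfl⟩ :=
      HomogeneousLocalization.Away.mk_surjective δ.grading δ.t_mem_grading z
    rw [dehomogenize_mk] at hz
    ext
    rw [HomogeneousLocalization.Away.val_mk, δ.forget_eq_zero_of_mem_grading hx hz,
      Localization.mk_zero, HomogeneousLocalization.val_zero]
  · intro f
    obtain ⟨d, hd⟩ := δ.exists_mem_filtration f
    refine ⟨HomogeneousLocalization.Away.mk δ.grading δ.t_mem_grading d (δ.homog d f hd)
      (by simpa using δ.homog_mem_grading d f hd), ?_⟩
    rw [dehomogenize_mk, forget_homog]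

instance isIso_dehomogenize : IsIso (Spec.map (CommRingCat.ofHom δ.dehomogenize)) := by
  have : IsIso (CommRingCat.ofHom δ.dehomogenize) :=
    (RingEquiv.ofBijective _ δ.dehomogenize_bijective).toCommRingCatIso.isIso_hom
  infer_instance

instance isOpenImmersion_completion : IsOpenImmersion δ.completion := by
  unfold completion
  infer_instance

theorem range_completion :
    Set.range δ.completion = (Proj.basicOpen δ.grading δ.t : Set (Proj δ.grading)) := by
  rw [← Proj.opensRange_awayι δ.grading δ.t δ.t_mem_grading Nat.one_pos]
  have h := Scheme.Hom.opensRange_comp_of_isIso (Spec.map (CommRingCat.ofHom δ.dehomogenize))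
    (Proj.awayι δ.grading δ.t δ.t_mem_grading Nat.one_pos)
  exact congrArg (fun U : (Proj δ.grading).Opens => (U : Set (Proj δ.grading))) h

/-- The description `p ↦ ⨁_d (p ∩ F_d)` of the natural map on points, in positive degrees. -/
theorem homog_mem_completion {d : ℕ} (hd : 0 < d) {f : A} (hf : f ∈ δ.filtration d)
    (x : Spec (CommRingCat.of A)) :
    δ.homog d f hf ∈ (δ.completion x).asHomogeneousIdeal ↔
      f ∈ (show PrimeSpectrum A from x).asIdeal := by
  rw [← not_iff_not, ← Proj.mem_basicOpen]
  have h := Proj.awayι_preimage_basicOpen δ.grading δ.t_mem_grading Nat.one_pos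
    (δ.homog_mem_grading d f hf) hd
  have h1 : δ.completion x ∈ Proj.basicOpen δ.grading (δ.homog d f hf) ↔
      Spec.map (CommRingCat.ofHom δ.dehomogenize) x ∈
        (Proj.awayι δ.grading δ.t δ.t_mem_grading Nat.one_pos ⁻¹ᵁ
          Proj.basicOpen δ.grading (δ.homog d f hf)) := Iff.rfl
  rw [h1, h]
  change ¬ (δ.dehomogenize _ ∈ (show PrimeSpectrum A from x).asIdeal) ↔ _
  rw [HomogeneousLocalization.Away.isLocalizationElem, dehomogenize_mk, map_pow, forget_homog,
    pow_one]

end Completion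

section Dominant

variable {K : Type w} {A : Type u} [Field K] [CommRing A] [IsDomain A] [Algebra K A]
  (δ : DegreeLike K A)

theorem t_ne_zero : δ.t ≠ 0 := fun h => by
  have := congrArg δ.forget h
  rw [t, forget_homog, map_zero] at this
  exact one_ne_zero this

/-- The zero ideal of the domain `A^δ` is the generic point of `Proj A^δ`, and it lies in the
image of `Spec A` because `t ≠ 0`. -/
instance isDominant_completion : IsDominant δ.completion := by
  let η : ProjectiveSpectrum δ.grading :=
    { asHomogeneousIdeal := ⊥
      isPrime := by
        rw [HomogeneousIdeal.toIdeal_bot]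
        exact Ideal.isPrime_bot
      not_irrelevant_le := fun h => by
        have h1 : δ.t ∈ HomogeneousIdeal.irrelevant δ.grading := by
          rw [HomogeneousIdeal.mem_irrelevant_iff, GradedRing.proj_apply,
            DirectSum.decompose_of_mem_ne δ.grading δ.t_mem_grading one_ne_zero]
        exact δ.t_ne_zero (h h1) }
  have hη : η ∈ Set.range δ.completion := by
    rw [range_completion]
    exact δ.t_ne_zero
  refine ⟨fun y => closure_mono (Set.singleton_subset_iff.2 hη) ?_⟩
  exact (ProjectiveSpectrum.le_iff_mem_closure δ.grading η y).1 (bot_le (a := y.asHomogeneousIdeal))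

end Dominant

section Preserves

variable {K : Type w} {A : Type u} [Field K] [CommRing A] [Algebra K A] (δ : DegreeLike K A)

/-- A point at infinity in the closures of all `V i` is a relevant homogeneous prime containing `t`
and every `(f)_d` with `f` vanishing on some `V i`. -/
theorem preservesIntersectionAtInfinity_of_irrelevant_le {ι : Type*} (I : ι → Ideal A)
    (h : ∀ P : HomogeneousIdeal δ.grading, P.toIdeal.IsPrime → δ.t ∈ P →
      (∀ i d f, 0 < d → f ∈ I i → ∀ hf : f ∈ δ.filtration (d : ℕ), δ.homog d f hf ∈ P) →
      HomogeneousIdeal.irrelevant δ.grading ≤ P) :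
    PreservesIntersectionAtInfinity δ.completion
      (fun i => (PrimeSpectrum.zeroLocus (I i : Set A) : Set (Spec (CommRingCat.of A)))) := by
  refine Set.eq_empty_iff_forall_notMem.2 ?_
  rintro P ⟨hP, hP'⟩
  rw [range_completion] at hP'
  refine ProjectiveSpectrum.not_irrelevant_le P (h P.asHomogeneousIdeal P.isPrime ?_ ?_)
  · exact not_not.1 hP'
  · intro i d f hd hfi hf
    have hcl : IsClosed (ProjectiveSpectrum.zeroLocus δ.grading {δ.homog d f hf}) :=
      ProjectiveSpectrum.isClosed_zeroLocus _ _
    have hsub : δ.completion '' (PrimeSpectrum.zeroLocus (I i : Set A)) ⊆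
        ProjectiveSpectrum.zeroLocus δ.grading {δ.homog d f hf} := by
      rintro _ ⟨x, hx, rfl⟩
      exact Set.singleton_subset_iff.2 ((δ.homog_mem_completion hd hf x).2 (hx hfi))
    have hmem := closure_minimal hsub hcl (Set.mem_iInter.1 hP i)
    exact hmem rfl

end Preserves

end DegreeLike

/-! ### Degree like functions from filtrations -/

namespace DegreeLike

section OfFiltration

variable {K A : Type*} [Field K] [CommRing A] [Algebra K A]

open Classical in
/-- The degree of `f` with respect to an exhaustive filtration `F`: the least `d` with `f ∈ F d`,
and `⊥` if `f = 0`. -/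
noncomputable def filtrationDegree (F : ℕ → Submodule K A) (hF : ∀ f, ∃ d, f ∈ F d) (f : A) :
    WithBot ℤ :=
  if f = 0 then ⊥ else ((Nat.find (hF f) : ℤ) : WithBot ℤ)

variable {F : ℕ → Submodule K A} (hF : ∀ f, ∃ d, f ∈ F d)

theorem filtrationDegree_le_iff (hmono : Monotone F) {f : A} {d : ℕ} :
    filtrationDegree F hF f ≤ ((d : ℤ) : WithBot ℤ) ↔ f ∈ F d := by
  classical
  unfold filtrationDegree
  split_ifs with h
  · simp [h]
  · rw [WithBot.coe_le_coe, Int.ofNat_le]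
    exact ⟨fun h1 => hmono h1 (Nat.find_spec (hF f)), fun h1 => Nat.find_min' _ h1⟩

theorem filtrationDegree_eq_coe {f : A} (hf : f ≠ 0) :
    ∃ d : ℕ, filtrationDegree F hF f = ((d : ℤ) : WithBot ℤ) := by
  unfold filtrationDegree
  rw [if_neg hf]
  exact ⟨_, rfl⟩

theorem filtrationDegree_zero : filtrationDegree F hF 0 = ⊥ := if_pos rfl

theorem filtrationDegree_neg (hmono : Monotone F) (f : A) :
    filtrationDegree F hF (-f) = filtrationDegree F hF f := by
  have key : ∀ g : A, filtrationDegree F hF (-g) ≤ filtrationDegree F hF g := fun g => by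
    by_cases h : g = 0
    · simp [h]
    · obtain ⟨d, hd⟩ := filtrationDegree_eq_coe hF h
      rw [hd, filtrationDegree_le_iff hF hmono, neg_mem_iff, ← filtrationDegree_le_iff hF hmono, hd]
  exact le_antisymm (key f) (by simpa using key (-f))

theorem filtrationDegree_add_le (hmono : Monotone F) (f g : A) :
    filtrationDegree F hF (f + g) ≤ max (filtrationDegree F hF f) (filtrationDegree F hF g) := by
  by_cases hf : f = 0
  · simp [hf]
  by_cases hg : g = 0
  · simp [hg]
  obtain ⟨d, hd⟩ := filtrationDegree_eq_coe hF hf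
  obtain ⟨e, he⟩ := filtrationDegree_eq_coe hF hg
  have h1 := (filtrationDegree_le_iff hF hmono).1 hd.le
  have h2 := (filtrationDegree_le_iff hF hmono).1 he.le
  rw [hd, he, ← WithBot.coe_max, ← Nat.cast_max, filtrationDegree_le_iff hF hmono]
  exact add_mem (hmono (le_max_left _ _) h1) (hmono (le_max_right _ _) h2)

/-- The ultrametric inequality for a map invariant under negation is strict only between
elements of equal value. -/
theorem eq_of_add_lt_max {v : A → WithBot ℤ} (hneg : ∀ f, v (-f) = v f)
    (hadd : ∀ f g, v (f + g) ≤ max (v f) (v g)) {f g : A} (h : v (f + g) < max (v f) (v g)) :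
    v f = v g := by
  by_contra hne
  rcases lt_or_gt_of_ne hne with h1 | h1
  · rw [max_eq_right h1.le] at h
    have h2 := hadd (f + g) (-f)
    rw [add_neg_cancel_comm, hneg] at h2
    exact absurd h2 (not_le.2 (max_lt h h1))
  · rw [max_eq_left h1.le] at h
    have h2 := hadd (f + g) (-g)
    rw [add_neg_cancel_right, hneg] at h2
    exact absurd h2 (not_le.2 (max_lt h h1))

/-- The degree like function of an increasing, exhaustive, multiplicative filtration indexed by
`ℕ` (so that all pieces of negative degree are zero). -/
noncomputable def ofFiltration (F : ℕ → Submodule K A) (hF : ∀ f, ∃ d, f ∈ F d)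
    (hmono : Monotone F) (hone : (1 : A) ∈ F 0)
    (hmul : ∀ d e f g, f ∈ F d → g ∈ F e → f * g ∈ F (d + e)) : DegreeLike K A where
  toFun := filtrationDegree F hF
  eq_bot_iff' f := by
    refine ⟨fun h => ?_, fun h => h ▸ filtrationDegree_zero hF⟩
    by_contra hf
    obtain ⟨d, hd⟩ := filtrationDegree_eq_coe hF hf
    rw [hd] at h
    exact WithBot.coe_ne_bot h
  const_le' c := by
    refine (filtrationDegree_le_iff hF hmono (d := 0)).2 ?_
    rw [Algebra.algebraMap_eq_smul_one]
    exact Submodule.smul_mem _ c hone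
  add_le' := filtrationDegree_add_le hF hmono
  eq_of_add_lt' _ _ :=
    eq_of_add_lt_max (filtrationDegree_neg hF hmono) (filtrationDegree_add_le hF hmono)
  mul_le' f g := by
    by_cases hf : f = 0
    · simp [hf, filtrationDegree_zero]
    by_cases hg : g = 0
    · simp [hg, filtrationDegree_zero]
    obtain ⟨d, hd⟩ := filtrationDegree_eq_coe hF hf
    obtain ⟨e, he⟩ := filtrationDegree_eq_coe hF hg
    have h1 := (filtrationDegree_le_iff hF hmono).1 hd.le
    have h2 := (filtrationDegree_le_iff hF hmono).1 he.le
    rw [hd, he, ← WithBot.coe_add, ← Nat.cast_add, filtrationDegree_le_iff hF hmono]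
    exact hmul _ _ _ _ h1 h2

variable (hmono : Monotone F) (hone : (1 : A) ∈ F 0)
  (hmul : ∀ d e f g, f ∈ F d → g ∈ F e → f * g ∈ F (d + e))

theorem filtration_ofFiltration (d : ℕ) :
    (ofFiltration F hF hmono hone hmul).filtration d = F d :=
  Submodule.ext fun _ => filtrationDegree_le_iff hF hmono

theorem filtration_ofFiltration_of_neg {d : ℤ} (hd : d < 0) :
    (ofFiltration F hF hmono hone hmul).filtration d = ⊥ := by
  rw [eq_bot_iff]
  intro f hf
  by_contra h
  obtain ⟨n, hn⟩ := filtrationDegree_eq_coe hF (f := f) (fun h1 => h (h1 ▸ zero_mem _))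
  have h1 : filtrationDegree F hF f ≤ (d : WithBot ℤ) := hf
  rw [hn, WithBot.coe_le_coe] at h1
  lia

end OfFiltration

/-! ### Quasidegrees from radical ideals at infinity -/

section Quasidegree

variable {K A : Type*} [Field K] [CommRing A] [Algebra K A] (δ : DegreeLike K A)

theorem homog_add_right {d : ℕ} {f : A} (hf : f ∈ δ.filtration d) (k : ℕ)
    (h : f ∈ δ.filtration (d + k : ℕ)) : δ.homog (d + k) f h = δ.t ^ k * δ.homog d f hf := by
  apply Subtype.ext
  change Polynomial.monomial (d + k) f = (Polynomial.monomial 1 (1 : A)) ^ k *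
    Polynomial.monomial d f
  rw [Polynomial.monomial_pow, Polynomial.monomial_mul_monomial, one_pow, one_mul, one_mul,
    add_comm]

theorem homog_ne_zero {d : ℕ} {f : A} (hf : f ∈ δ.filtration d) (h : f ≠ 0) :
    δ.homog d f hf ≠ 0 := fun h1 => h <| by
  have := congrArg δ.forget h1
  rwa [forget_homog, map_zero] at this

theorem exists_eq_natCast (hneg : ∀ d : ℤ, d < 0 → δ.filtration d = ⊥) {f : A} (h : f ≠ 0) :
    ∃ n : ℕ, δ f = ((n : ℤ) : WithBot ℤ) := by
  rcases hd : δ f with _ | d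
  · exact absurd ((δ.eq_bot_iff' f).1 hd) h
  · have h0 : 0 ≤ d := by
      by_contra hlt
      have h2 : f ∈ δ.filtration d := hd.le
      rw [hneg d (not_le.1 hlt)] at h2
      exact h h2
    obtain ⟨n, rfl⟩ := Int.eq_ofNat_of_zero_le h0
    exact ⟨n, rfl⟩

theorem homog_notMem_span_t {d : ℕ} {f : A}
    (hf : f ∈ δ.filtration d) (h : δ f = ((d : ℤ) : WithBot ℤ)) :
    δ.homog d f hf ∉ Ideal.span {δ.t} := by
  intro hmem
  obtain ⟨g, hg⟩ := Ideal.mem_span_singleton'.1 hmem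
  have h1 := congrArg (fun p : δ.gradedRing => (p : Polynomial A).coeff d) hg
  change ((g : Polynomial A) * Polynomial.monomial 1 1).coeff d =
    (Polynomial.monomial d f).coeff d at h1
  rw [Polynomial.coeff_monomial, if_pos rfl, Polynomial.monomial_one_one_eq_X] at h1
  have h2 : f ∈ δ.filtration (d - 1 : ℤ) := by
    rcases d with _ | d
    · rw [Polynomial.coeff_mul_X_zero] at h1
      rw [← h1]
      exact zero_mem _
    · rw [Polynomial.coeff_mul_X] at h1
      rw [← h1]
      simpa using g.2 d
  rw [mem_filtration, h, WithBot.coe_le_coe] at h2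
  lia

variable {S : Type*} [CommRing S] (φ : δ.gradedRing →+* S)

open Classical in
/-- The degree on `A` obtained from the order of vanishing along `φ t = 0` on a ring `S` over
`A^δ`: a nonzero `f ∈ F_d` has degree `d - ord (φ (f)_d)`, for any such `d`. -/
noncomputable def vanishingDegree (f : A) : WithBot ℤ :=
  if f = 0 then ⊥ else
    (((δ.exists_mem_filtration f).choose -
      multiplicity (φ δ.t) (φ (δ.homog _ f (δ.exists_mem_filtration f).choose_spec)) : ℤ) :
      WithBot ℤ)

theorem vanishingDegree_zero : δ.vanishingDegree φ 0 = ⊥ := if_pos rfl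

variable {φ} [IsDomain S] [WfDvdMonoid S] (hφ : Function.Injective φ) (hp : Prime (φ δ.t))

include hφ hp

theorem finiteMultiplicity_homog {d : ℕ} {f : A} (hf : f ∈ δ.filtration d) (h : f ≠ 0) :
    FiniteMultiplicity (φ δ.t) (φ (δ.homog d f hf)) :=
  FiniteMultiplicity.of_not_isUnit hp.not_isUnit
    ((map_ne_zero_iff φ hφ).2 (δ.homog_ne_zero hf h))

theorem vanishingDegree_eq {d : ℕ} {f : A} (hf : f ∈ δ.filtration d) (h : f ≠ 0) :
    δ.vanishingDegree φ f =
      ((d - multiplicity (φ δ.t) (φ (δ.homog d f hf)) : ℤ) : WithBot ℤ) := by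
  have key : ∀ (a k : ℕ) (ha : f ∈ δ.filtration a) (hk : f ∈ δ.filtration (a + k : ℕ)),
      (a - multiplicity (φ δ.t) (φ (δ.homog a f ha)) : ℤ) =
        ((a + k : ℕ) - multiplicity (φ δ.t) (φ (δ.homog (a + k) f hk)) : ℤ) := by
    intro a k ha hk
    have h1 := δ.finiteMultiplicity_homog hφ hp hk h
    rw [δ.homog_add_right ha k hk, map_mul, map_pow] at h1 ⊢
    rw [multiplicity_mul hp h1,
      multiplicity_pow_self_of_prime hp]
    push_cast
    ring
  unfold vanishingDegree
  rw [if_neg h, WithBot.coe_inj]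
  have key' : ∀ (a b : ℕ) (ha : f ∈ δ.filtration a) (hb : f ∈ δ.filtration b),
      (a - multiplicity (φ δ.t) (φ (δ.homog a f ha)) : ℤ) =
        (b - multiplicity (φ δ.t) (φ (δ.homog b f hb)) : ℤ) := by
    intro a b ha hb
    rcases le_total a b with hle | hle
    · obtain ⟨k, rfl⟩ := Nat.exists_eq_add_of_le hle
      exact key a k ha hb
    · obtain ⟨k, rfl⟩ := Nat.exists_eq_add_of_le hle
      exact (key b k hb ha).symm
  exact key' _ d _ hf

theorem vanishingDegree_le_iff {d : ℕ} {f : A} (hf : f ∈ δ.filtration d) (n : ℕ) :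
    δ.vanishingDegree φ f ≤ ((d - n : ℤ) : WithBot ℤ) ↔ φ δ.t ^ n ∣ φ (δ.homog d f hf) := by
  by_cases h : f = 0
  · subst h
    simp [vanishingDegree_zero, homog_zero]
  · rw [δ.vanishingDegree_eq hφ hp hf h, WithBot.coe_le_coe,
      (δ.finiteMultiplicity_homog hφ hp hf h).pow_dvd_iff_le_multiplicity]
    lia

theorem exists_vanishingDegree_eq {d : ℕ} {f : A} (hf : f ∈ δ.filtration d) (h : f ≠ 0) :
    ∃ n : ℕ, δ.vanishingDegree φ f = ((d - n : ℤ) : WithBot ℤ) :=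
  ⟨_, δ.vanishingDegree_eq hφ hp hf h⟩

theorem vanishingDegree_neg (f : A) : δ.vanishingDegree φ (-f) = δ.vanishingDegree φ f := by
  have key : ∀ g : A, δ.vanishingDegree φ (-g) ≤ δ.vanishingDegree φ g := fun g => by
    by_cases h : g = 0
    · simp [h]
    · obtain ⟨d, hd⟩ := δ.exists_mem_filtration g
      obtain ⟨n, hn⟩ := δ.exists_vanishingDegree_eq hφ hp hd h
      have h1 := (δ.vanishingDegree_le_iff hφ hp hd n).1 hn.le
      rw [hn, δ.vanishingDegree_le_iff hφ hp (neg_mem hd)]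
      have h2 : δ.homog d (-g) (neg_mem hd) = -δ.homog d g hd :=
        Subtype.ext (map_neg (Polynomial.monomial d) g)
      rw [h2, map_neg]
      exact h1.neg_right
  exact le_antisymm (key f) (by simpa using key (-f))

theorem vanishingDegree_add_le (f g : A) :
    δ.vanishingDegree φ (f + g) ≤ max (δ.vanishingDegree φ f) (δ.vanishingDegree φ g) := by
  by_cases h : f = 0
  · simp [h]
  by_cases h' : g = 0
  · simp [h']
  obtain ⟨a, ha⟩ := δ.exists_mem_filtration f
  obtain ⟨b, hb⟩ := δ.exists_mem_filtration g
  have hf := δ.filtration_mono (Int.ofNat_le.2 (le_max_left a b)) ha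
  have hg := δ.filtration_mono (Int.ofNat_le.2 (le_max_right a b)) hb
  generalize max a b = d at hf hg
  obtain ⟨m, hm⟩ := δ.exists_vanishingDegree_eq hφ hp hf h
  obtain ⟨n, hn⟩ := δ.exists_vanishingDegree_eq hφ hp hg h'
  have h1 := (δ.vanishingDegree_le_iff hφ hp hf m).1 hm.le
  have h2 := (δ.vanishingDegree_le_iff hφ hp hg n).1 hn.le
  have h3 : max ((d - m : ℤ) : WithBot ℤ) ((d - n : ℤ) : WithBot ℤ) =
      ((d - (min m n : ℕ) : ℤ) : WithBot ℤ) := by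
    rw [← WithBot.coe_max, WithBot.coe_inj]
    lia
  rw [hm, hn, h3, δ.vanishingDegree_le_iff hφ hp (add_mem hf hg), δ.homog_add hf hg, map_add]
  exact dvd_add ((pow_dvd_pow _ (min_le_left m n)).trans h1)
    ((pow_dvd_pow _ (min_le_right m n)).trans h2)

variable [IsDomain A]

theorem vanishingDegree_mul (f g : A) :
    δ.vanishingDegree φ (f * g) = δ.vanishingDegree φ f + δ.vanishingDegree φ g := by
  by_cases h : f = 0
  · simp [h, vanishingDegree_zero]
  by_cases h' : g = 0
  · simp [h', vanishingDegree_zero]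
  obtain ⟨d, hf⟩ := δ.exists_mem_filtration f
  obtain ⟨e, hg⟩ := δ.exists_mem_filtration g
  have hfg : f * g ∈ δ.filtration (d + e : ℕ) := by
    exact_mod_cast δ.mul_mem_filtration hf hg
  have h1 := δ.finiteMultiplicity_homog hφ hp hfg (mul_ne_zero h h')
  rw [δ.vanishingDegree_eq hφ hp hf h, δ.vanishingDegree_eq hφ hp hg h',
    δ.vanishingDegree_eq hφ hp hfg (mul_ne_zero h h')]
  rw [δ.homog_mul hf hg hfg, map_mul] at h1 ⊢
  rw [multiplicity_mul hp h1, ← WithBot.coe_add, WithBot.coe_inj]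
  push_cast
  ring

/-- The vanishing degree along a prime element over `t`, as a degree like function. -/
noncomputable def vanishing : DegreeLike K A where
  toFun := δ.vanishingDegree φ
  eq_bot_iff' f := by
    refine ⟨fun h => ?_, fun h => h ▸ δ.vanishingDegree_zero φ⟩
    by_contra hf
    obtain ⟨d, hd⟩ := δ.exists_mem_filtration f
    obtain ⟨n, hn⟩ := δ.exists_vanishingDegree_eq hφ hp hd hf
    rw [hn] at h
    exact WithBot.coe_ne_bot h
  const_le' c := by
    have h : algebraMap K A c ∈ δ.filtration (0 : ℕ) := δ.const_le' c
    simpa using (δ.vanishingDegree_le_iff hφ hp h 0).2 (by simp)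
  add_le' := δ.vanishingDegree_add_le hφ hp
  eq_of_add_lt' _ _ :=
    eq_of_add_lt_max (δ.vanishingDegree_neg hφ hp) (δ.vanishingDegree_add_le hφ hp)
  mul_le' f g := (δ.vanishingDegree_mul hφ hp f g).le

theorem isSemidegree_vanishing : (δ.vanishing hφ hp).IsSemidegree :=
  δ.vanishingDegree_mul hφ hp

omit [IsDomain A] in
theorem vanishingDegree_le (hneg : ∀ d : ℤ, d < 0 → δ.filtration d = ⊥) (f : A) :
    δ.vanishingDegree φ f ≤ δ f := by
  by_cases h : f = 0
  · rw [h, vanishingDegree_zero]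
    exact bot_le
  · obtain ⟨n, hn⟩ := δ.exists_eq_natCast hneg h
    rw [hn]
    simpa using (δ.vanishingDegree_le_iff hφ hp (d := n) hn.le 0).2 (by simp)

omit [IsDomain A] in
theorem vanishingDegree_eq_of_isUnit {d : ℕ} {f : A} (hf : f ∈ δ.filtration d) (h : f ≠ 0)
    (hu : IsUnit (φ (δ.homog d f hf))) :
    δ.vanishingDegree φ f = ((d : ℤ) : WithBot ℤ) := by
  have h6 : ¬ φ δ.t ∣ φ (δ.homog d f hf) := fun hdvd =>
    hp.not_isUnit (isUnit_of_dvd_unit hdvd hu)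
  rw [δ.vanishingDegree_eq hφ hp hf h, multiplicity_eq_zero.2 h6]
  simp

end Quasidegree

section QuasidegreeOfRadical

variable {K A : Type*} [Field K] [CommRing A] [IsDomain A] [Algebra K A] (δ : DegreeLike K A)

/-- If `(t)` is a radical ideal, then it generates the maximal ideal of the local ring of `A^δ` at
each of its minimal primes. -/
theorem prime_t_of_mem_minimalPrimes (hrad : (Ideal.span {δ.t}).IsRadical)
    {p : Ideal δ.gradedRing} [p.IsPrime] (hp : p ∈ (Ideal.span {δ.t}).minimalPrimes)
    (S : Type*) [CommRing S] [IsDomain S] [Algebra δ.gradedRing S] [IsLocalization.AtPrime S p] :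
    Prime (algebraMap δ.gradedRing S δ.t) := by
  have hinj : Function.Injective (algebraMap δ.gradedRing S) :=
    IsLocalization.injective S (Ideal.primeCompl_le_nonZeroDivisors p)
  have : IsLocalRing S := IsLocalization.AtPrime.isLocalRing S p
  rw [← Ideal.span_singleton_prime ((map_ne_zero_iff _ hinj).2 δ.t_ne_zero)]
  have hmax : Ideal.span {algebraMap δ.gradedRing S δ.t} = IsLocalRing.maximalIdeal S := by
    rw [← IsLocalization.AtPrime.map_eq_maximalIdeal p, ← Set.image_singleton, ← Ideal.map_span,
      ← IsLocalization.AtPrime.radical_map_of_mem_minimalPrimes _ p _ hp,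
      ← IsLocalization.map_radical p.primeCompl, hrad.radical]
  rw [hmax]
  exact (IsLocalRing.maximalIdeal.isMaximal _).isPrime

theorem exists_semidegree_of_isLocalization [IsNoetherianRing δ.gradedRing]
    (hneg : ∀ d : ℤ, d < 0 → δ.filtration d = ⊥) (hrad : (Ideal.span {δ.t}).IsRadical)
    {p : Ideal δ.gradedRing} [p.IsPrime] (hp : p ∈ (Ideal.span {δ.t}).minimalPrimes)
    (S : Type*) [CommRing S] [IsDomain S] [Algebra δ.gradedRing S] [IsLocalization.AtPrime S p] :
    ∃ s : DegreeLike K A, s.IsSemidegree ∧ (∀ f, s f ≤ δ f) ∧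
      ∀ (d : ℕ) (f : A) (hf : f ∈ δ.filtration d), f ≠ 0 → δ.homog d f hf ∉ p →
        s f = ((d : ℤ) : WithBot ℤ) := by
  have : IsNoetherianRing S := IsLocalization.isNoetherianRing p.primeCompl S ‹_›
  have hinj : Function.Injective (algebraMap δ.gradedRing S) :=
    IsLocalization.injective S (Ideal.primeCompl_le_nonZeroDivisors p)
  have hpr := δ.prime_t_of_mem_minimalPrimes hrad hp S
  exact ⟨δ.vanishing hinj hpr, δ.isSemidegree_vanishing hinj hpr,
    δ.vanishingDegree_le hinj hpr hneg, fun d f hf h hfp =>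
    δ.vanishingDegree_eq_of_isUnit hinj hpr hf h
      (IsLocalization.map_units (M := p.primeCompl) S ⟨_, hfp⟩)⟩

/-- A non-negative degree like function whose graded ring is Noetherian and in which `t` generates
a radical ideal is the maximum of the vanishing degrees along the minimal primes of `(t)`. -/
theorem isQuasidegree_of_isRadical [IsNoetherianRing δ.gradedRing]
    (hneg : ∀ d : ℤ, d < 0 → δ.filtration d = ⊥) (hrad : (Ideal.span {δ.t}).IsRadical) :
    δ.IsQuasidegree := by
  have hfin := Ideal.finite_minimalPrimes_of_isNoetherianRing δ.gradedRing (Ideal.span {δ.t})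
  obtain ⟨N, p, -, hp⟩ := hfin.fin_param
  have hmem : ∀ i, p i ∈ (Ideal.span {δ.t}).minimalPrimes := fun i => hp ▸ Set.mem_range_self i
  have hprime : ∀ i, (p i).IsPrime := fun i => (hmem i).1.1
  choose s hs hle heq using fun i =>
    δ.exists_semidegree_of_isLocalization hneg hrad (hmem i) (Localization.AtPrime (p i))
  have hex : ∀ f, f ≠ 0 → ∃ i, s i f = δ f := by
    intro f h
    obtain ⟨n, hn⟩ := δ.exists_eq_natCast hneg h
    have h3 := δ.homog_notMem_span_t (d := n) hn.le hn
    rw [← hrad.radical, ← Ideal.sInf_minimalPrimes, Submodule.mem_sInf] at h3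
    push Not at h3
    obtain ⟨q, hq, hfq⟩ := h3
    have hq' : q ∈ Set.range p := hp.symm ▸ hq
    obtain ⟨i, rfl⟩ := hq'
    exact ⟨i, (heq i n f hn.le h hfq).trans hn.symm⟩
  refine ⟨N, s, ?_, hs, fun f => ?_⟩
  · obtain ⟨i, -⟩ := hex 1 one_ne_zero
    exact Fin.pos i
  · refine le_antisymm ?_ (Finset.sup_le fun i _ => hle i f)
    by_cases h : f = 0
    · rw [(δ.eq_bot_iff' f).2 h]
      exact bot_le
    · obtain ⟨i, hi⟩ := hex f h
      rw [← hi]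
      exact Finset.le_sup (f := fun i => s i f) (Finset.mem_univ i)

end QuasidegreeOfRadical

end DegreeLike

/-! ### Finiteness of integral closures over a perfect field -/

theorem RingHom.Finite.module_finite_of_injective {T C D : Type*} [CommRing T] [IsNoetherianRing T]
    [CommRing C] [CommRing D] [Algebra T C] {ψ : T →+* D} (hψ : ψ.Finite) (θ : C →+* D)
    (hθ : Function.Injective θ) (hcomp : θ.comp (algebraMap T C) = ψ) : Module.Finite T C := by
  let := ψ.toAlgebra
  have : Module.Finite T D := hψ
  let θ' : C →ₐ[T] D := { θ with commutes' := fun r => RingHom.congr_fun hcomp r }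
  exact Module.Finite.of_injective θ'.toLinearMap hθ

/-- The Frobenius endomorphism of an algebra of finite type over a perfect field is finite. -/
theorem finite_iterateFrobenius (K T : Type*) [Field K] [PerfectField K] [CommRing T]
    [Algebra K T] [Algebra.FiniteType K T] (p n : ℕ) [ExpChar K p] [ExpChar T p] :
    (iterateFrobenius T p n).Finite := by
  refine RingHom.IsIntegral.to_finite (fun x => ?_) ?_
  · refine ⟨Polynomial.X ^ (p ^ n) - Polynomial.C x,
      Polynomial.monic_X_pow_sub_C x (expChar_pow_pos K p n).ne', ?_⟩
    simp [iterateFrobenius_def]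
  · refine RingHom.FiniteType.of_comp_finiteType (f := algebraMap K T) ?_
    have h : (iterateFrobenius T p n).comp (algebraMap K T) =
        (algebraMap K T).comp (iterateFrobenius K p n) := by
      ext x
      simp [iterateFrobenius_def]
    rw [h]
    refine RingHom.FiniteType.comp (RingHom.finiteType_algebraMap.2 ‹_›)
      (RingHom.FiniteType.of_surjective _ ?_)
    have := PerfectField.toPerfectRing (K := K) p
    exact (bijective_iterateFrobenius K p n).2

/-- The inseparable part of the extension is removed by a power of Frobenius, which is finite on
`T`. -/
theorem finite_integralClosure_of_finiteDimensional (K T F E : Type*) [Field K] [PerfectField K]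
    [CommRing T] [IsDomain T] [IsIntegrallyClosed T] [Algebra K T] [Algebra.FiniteType K T]
    [Field F] [Field E] [Algebra T F] [IsFractionRing T F] [Algebra T E] [Algebra F E]
    [IsScalarTower T F E] [FiniteDimensional F E] :
    Module.Finite T (integralClosure T E) := by
  have : IsNoetherianRing T := Algebra.FiniteType.isNoetherianRing K T
  have hpK := ringExpChar.expChar K
  generalize ringExpChar K = p at hpK
  have hpT : ExpChar T p := expChar_of_injective_algebraMap (algebraMap K T).injective p
  have hpF : ExpChar F p := expChar_of_injective_algebraMap (IsFractionRing.injective T F) p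
  let M := separableClosure F E
  have hpM : ExpChar M p := expChar_of_injective_algebraMap (algebraMap F M).injective p
  have : IsScalarTower T M E := IsScalarTower.of_algebraMap_eq fun _ => rfl
  let n := IsPurelyInseparable.exponent M E
  let φ : E →+* M := IsPurelyInseparable.iterateFrobenius M E p (le_refl n)
  have hφ : ∀ a : E, ((φ a : M) : E) = a ^ p ^ n :=
    IsPurelyInseparable.algebraMap_iterateFrobenius M p (le_refl n)
  have : Module.Finite T (integralClosure T M) :=
    IsIntegralClosure.finite T F M (integralClosure T M)
  have hint : ∀ c : integralClosure T E, φ c ∈ integralClosure T M := fun c => by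
    have h : IsIntegral T ((φ c : M) : E) := by
      rw [hφ]
      exact c.2.pow _
    exact (isIntegral_algebraMap_iff (algebraMap M E).injective).1 h
  let θ : integralClosure T E →+* integralClosure T M :=
    (φ.comp (algebraMap (integralClosure T E) E)).codRestrict (integralClosure T M) hint
  have hfin : ((algebraMap T (integralClosure T M)).comp (iterateFrobenius T p n)).Finite :=
    RingHom.Finite.comp (RingHom.finite_algebraMap.2 ‹_›) (finite_iterateFrobenius K T p n)
  refine hfin.module_finite_of_injective θ ?_ ?_
  · intro a b hab
    have h : φ (a : E) = φ (b : E) := congrArg Subtype.val hab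
    exact Subtype.ext (φ.injective h)
  · ext x
    change ((φ (algebraMap T E x) : M) : E) = algebraMap T E (iterateFrobenius T p n x)
    rw [hφ, iterateFrobenius_def, map_pow]

/-- The integral closure of an integrally closed domain `T` of finite type over a perfect field in
an algebraic domain extension of finite type is a finite `T`-module. -/
theorem finite_integralClosure_of_isAlgebraic (K T C : Type*) [Field K] [PerfectField K]
    [CommRing T] [IsDomain T] [IsIntegrallyClosed T] [Algebra K T] [Algebra.FiniteType K T]
    [CommRing C] [IsDomain C] [Algebra T C] [FaithfulSMul T C] [Algebra.FiniteType T C]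
    [Algebra.IsAlgebraic T C] : Module.Finite T (integralClosure T C) := by
  have : IsNoetherianRing T := Algebra.FiniteType.isNoetherianRing K T
  let F := FractionRing T
  let E := FractionRing C
  have : FaithfulSMul T E := FaithfulSMul.trans T C E
  let := FractionRing.liftAlgebra T E
  have : IsScalarTower T F E := FractionRing.isScalarTower_liftAlgebra T E
  have : Algebra.IsAlgebraic C E := IsLocalization.isAlgebraic E (nonZeroDivisors C)
  have : Algebra.IsAlgebraic T E := Algebra.IsAlgebraic.trans T C E
  have : Algebra.IsAlgebraic F E := IsFractionRing.comap_isAlgebraic_iff.1 this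
  have : Algebra.EssFiniteType C E := Algebra.EssFiniteType.of_isLocalization E (nonZeroDivisors C)
  have : Algebra.EssFiniteType T E := Algebra.EssFiniteType.comp T C E
  have : Algebra.EssFiniteType F E := Algebra.EssFiniteType.of_comp T F E
  have : FiniteDimensional F E := Algebra.finite_of_essFiniteType_of_isAlgebraic
  have := finite_integralClosure_of_finiteDimensional K T F E
  have hmap : ∀ c : integralClosure T C, algebraMap C E c ∈ integralClosure T E :=
    fun c => c.2.algebraMap
  let θ : integralClosure T C →ₐ[T] integralClosure T E :=
    ((IsScalarTower.toAlgHom T C E).comp (integralClosure T C).val).codRestrict _ hmap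
  refine Module.Finite.of_injective θ.toLinearMap fun a b hab => Subtype.ext ?_
  exact IsFractionRing.injective C E (congrArg Subtype.val hab)

/-! ### Linear Noether normalization compatible with degrees -/

theorem Subalgebra.isIntegral_of_forall_isIntegral {K C : Type*} [CommRing K] [CommRing C]
    [Algebra K C] {S₁ S₂ : Subalgebra K C} (h : ∀ x ∈ S₁, IsIntegral S₂ x) {x : C}
    (hx : IsIntegral S₁ x) : IsIntegral S₂ x := by
  let g : S₁ →+* integralClosure S₂ C :=
    S₁.val.toRingHom.codRestrict (integralClosure S₂ C) fun a => h a a.2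
  obtain ⟨p, hp, hpx⟩ := hx
  refine isIntegral_trans (A := integralClosure S₂ C) x ⟨p.map g, hp.map g, ?_⟩
  rw [Polynomial.eval₂_map]
  exact hpx

theorem Algebra.isIntegral_of_mem_adjoin {K C : Type*} [CommRing K] [CommRing C]
    [Algebra K C] {s : Set C} {S : Subalgebra K C} (h : ∀ x ∈ s, IsIntegral S x) {x : C}
    (hx : x ∈ Algebra.adjoin K s) : IsIntegral S x := by
  have hle : Algebra.adjoin K s ≤ (integralClosure S C).restrictScalars K :=
    Algebra.adjoin_le h
  exact hle hx

theorem Polynomial.natDegree_prod_linear_pow_le {B σ : Type*} [CommRing B]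
    (a c : σ → B) (m : σ →₀ ℕ) (s : Finset σ) :
    (∏ i ∈ s, (C (a i) + C (c i) * X) ^ m i).natDegree ≤ ∑ i ∈ s, m i := by
  refine (natDegree_prod_le _ _).trans (Finset.sum_le_sum fun i _ => ?_)
  refine natDegree_pow_le.trans ?_
  have h : (C (a i) + C (c i) * X).natDegree ≤ 1 := by
    rw [add_comm]
    exact natDegree_linear_le
  simpa using Nat.mul_le_mul_left (m i) h

theorem Polynomial.coeff_prod_linear_pow {B σ : Type*} [CommRing B]
    (a c : σ → B) (m : σ →₀ ℕ) (s : Finset σ) :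
    (∏ i ∈ s, (C (a i) + C (c i) * X) ^ m i).coeff (∑ i ∈ s, m i) = ∏ i ∈ s, c i ^ m i := by
  classical
  induction s using Finset.induction_on with
  | empty => simp
  | insert i s hi ih =>
    have h : (C (a i) + C (c i) * X).natDegree ≤ 1 := by
      rw [add_comm]
      exact natDegree_linear_le
    have h1 : ((C (a i) + C (c i) * X) ^ m i).natDegree ≤ m i := by
      simpa using natDegree_pow_le.trans (Nat.mul_le_mul_left (m i) h)
    have h2 : ((C (a i) + C (c i) * X) ^ m i).coeff (m i) = c i ^ m i := by
      have := coeff_pow_of_natDegree_le (m := m i) h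
      rw [mul_one] at this
      rw [this]
      simp
    rw [Finset.prod_insert hi, Finset.sum_insert hi, Finset.prod_insert hi,
      coeff_mul_add_eq_of_natDegree_le h1 (natDegree_prod_linear_pow_le a c m s), h2, ih]

/-- A relation `P (a + c w) = 0` of degree at most `D`, homogenized by `s`, makes `s w` integral
over any subalgebra containing `s` and the `s aᵢ`, provided that the part of `P` of degree `D` does
not vanish at `c`. -/
theorem isIntegral_mul_of_aeval_eq_zero {K C σ : Type*} [Field K] [CommRing C] [Algebra K C]
    [Fintype σ]
    (S : Subalgebra K C) {s : C} (hs : s ∈ S) {a : σ → C} (ha : ∀ i, s * a i ∈ S) (c : σ → K)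
    (w : C) (P : MvPolynomial σ K) {D : ℕ} (hD : P.totalDegree ≤ D)
    (hc : MvPolynomial.eval c (MvPolynomial.homogeneousComponent D P) ≠ 0)
    (hP : MvPolynomial.aeval (fun i => a i + algebraMap K C (c i) * w) P = 0) :
    IsIntegral S (s * w) := by
  classical
  -- `Q` is the relation `P (a + c Z) = 0` homogenized by `s`, with root `Z = s w`; its coefficient
  -- of degree `D` is the value at `c` of the part of `P` of degree `D`
  let a' : σ → S := fun i => ⟨s * a i, ha i⟩
  let c' : σ → S := fun i => algebraMap K S (c i)
  let term : (σ →₀ ℕ) → Polynomial S := fun m =>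
    Polynomial.C (algebraMap K S (P.coeff m) * ⟨s, hs⟩ ^ (D - ∑ i, m i)) *
      ∏ i, (Polynomial.C (a' i) + Polynomial.C (c' i) * Polynomial.X) ^ m i
  let Q : Polynomial S := ∑ m ∈ P.support, term m
  have hm : ∀ m ∈ P.support, ∑ i, m i ≤ D := fun m hm => by
    have := (MvPolynomial.le_totalDegree hm).trans hD
    rwa [Finsupp.sum_fintype _ _ (fun _ => rfl)] at this
  have hterm : ∀ m ∈ P.support, (term m).natDegree ≤ ∑ i, m i := fun m _ =>
    (Polynomial.natDegree_C_mul_le _ _).trans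
      (Polynomial.natDegree_prod_linear_pow_le a' c' m Finset.univ)
  have hQ : Q.natDegree ≤ D := Polynomial.natDegree_sum_le_of_forall_le _ _ fun m h =>
    (hterm m h).trans (hm m h)
  have hlead : Q.coeff D =
      algebraMap K S (MvPolynomial.eval c (MvPolynomial.homogeneousComponent D P)) := by
    rw [MvPolynomial.homogeneousComponent_apply, map_sum, map_sum, Finset.sum_filter,
      Polynomial.finsetSum_coeff]
    refine Finset.sum_congr rfl fun m h => ?_
    have hdeg : m.degree = ∑ i, m i := Finsupp.degree_eq_sum m
    split_ifs with h1
    · rw [hdeg] at h1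
      have h2 := Polynomial.coeff_prod_linear_pow a' c' m Finset.univ
      rw [h1] at h2
      rw [Polynomial.coeff_C_mul, h2, h1, Nat.sub_self, pow_zero, mul_one,
        MvPolynomial.eval_monomial, map_mul, Finsupp.prod_fintype _ _ (fun _ => pow_zero _),
        map_prod]
      simp [c']
    · rw [hdeg] at h1
      exact Polynomial.coeff_eq_zero_of_natDegree_lt
        ((hterm m h).trans_lt (lt_of_le_of_ne (hm m h) h1))
  have hroot : Polynomial.aeval (s * w) Q = 0 := by
    have h1 : Polynomial.aeval (s * w) Q =
        s ^ D * MvPolynomial.aeval (fun i => a i + algebraMap K C (c i) * w) P := by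
      rw [MvPolynomial.aeval_def, MvPolynomial.eval₂_eq', map_sum, Finset.mul_sum]
      refine Finset.sum_congr rfl fun m h => ?_
      have h2 : s ^ D = s ^ (D - ∑ i, m i) * ∏ i, s ^ m i := by
        rw [Finset.prod_pow_eq_pow_sum, ← pow_add, Nat.sub_add_cancel (hm m h)]
      have h3 : ∏ i, (s * a i + algebraMap K C (c i) * (s * w)) ^ m i =
          (∏ i, s ^ m i) * ∏ i, (a i + algebraMap K C (c i) * w) ^ m i := by
        rw [← Finset.prod_mul_distrib]
        exact Finset.prod_congr rfl fun i _ => by rw [← mul_pow]; ring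
      have h4 : Polynomial.aeval (s * w) (term m) =
          (algebraMap K C (P.coeff m) * s ^ (D - ∑ i, m i)) *
            ∏ i, (s * a i + algebraMap K C (c i) * (s * w)) ^ m i := by
        simp only [term, map_mul, map_prod, map_pow, map_add, Polynomial.aeval_C,
          Polynomial.aeval_X]
        rfl
      rw [h4, h3, h2]
      ring
    rw [h1, hP, mul_zero]
  let u := MvPolynomial.eval c (MvPolynomial.homogeneousComponent D P)
  refine ⟨Polynomial.C (algebraMap K S u⁻¹) * Q, ?_, ?_⟩
  · refine Polynomial.monic_of_natDegree_le_of_coeff_eq_one D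
      ((Polynomial.natDegree_C_mul_le _ _).trans hQ) ?_
    rw [Polynomial.coeff_C_mul, hlead, ← map_mul, inv_mul_cancel₀ hc, map_one]
  · have h : Polynomial.aeval (s * w) (Polynomial.C (algebraMap K S u⁻¹) * Q) = 0 := by
      rw [map_mul, hroot, mul_zero]
    exact h

/-- The subalgebra `K[s, s^e y₁, …, s^e yₙ]` of the polynomial ring `A[s]`. -/
noncomputable def reesAdjoin (K : Type*) {A ι : Type*} [Field K] [CommRing A] [Algebra K A] (e : ℕ)
    (y : ι → A) : Subalgebra K (Polynomial A) :=
  Algebra.adjoin K (insert Polynomial.X (Set.range fun i => Polynomial.monomial e (y i)))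

section ReesAdjoin

variable {K A ι : Type*} [Field K] [CommRing A] [Algebra K A] {e : ℕ} {y : ι → A}

theorem X_mem_reesAdjoin : Polynomial.X ∈ reesAdjoin K e y :=
  Algebra.subset_adjoin (Set.mem_insert _ _)

theorem monomial_mem_reesAdjoin (i : ι) : Polynomial.monomial e (y i) ∈ reesAdjoin K e y :=
  Algebra.subset_adjoin (Set.mem_insert_of_mem _ ⟨i, rfl⟩)

end ReesAdjoin

/-- Over an infinite field, finitely many elements `z` are integral, in the graded sense, over
algebraically independent linear combinations `y` of them: each relation among the `z` is made
monic in one variable by a linear change of variables, and this respects degrees. -/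
theorem exists_algebraicIndependent_isIntegral_reesAdjoin {K A : Type*} [Field K] [Infinite K]
    [CommRing A] [Nontrivial A] [Algebra K A] (N : ℕ) (z : Fin N → A) :
    ∃ (n : ℕ) (y : Fin n → A), AlgebraicIndependent K y ∧
      (∀ i, y i ∈ Submodule.span K (Set.range z)) ∧
      ∀ j, IsIntegral (reesAdjoin K 1 y) (Polynomial.monomial 1 (z j)) := by
  induction N with
  | zero =>
    refine ⟨0, z, ?_, fun i => i.elim0, fun j => j.elim0⟩
    exact algebraicIndependent_empty_type_iff.2 (algebraMap K A).injective
  | succ N ih =>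
    by_cases hz : AlgebraicIndependent K z
    · exact ⟨N + 1, z, hz, fun i => Submodule.subset_span ⟨i, rfl⟩, fun j =>
        isIntegral_algebraMap (x := (⟨_, monomial_mem_reesAdjoin j⟩ : reesAdjoin K 1 z))⟩
    rw [algebraicIndependent_iff] at hz
    push Not at hz
    obtain ⟨P, hP, hP0⟩ := hz
    have hcomp : MvPolynomial.homogeneousComponent P.totalDegree P ≠ 0 := by
      obtain ⟨m, hm, hdeg⟩ := Finset.exists_mem_eq_sup P.support
        (MvPolynomial.support_nonempty.2 hP0) fun m => m.degree
      have hdeg' : m.degree = P.totalDegree := hdeg.symm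
      intro h
      have h1 := congrArg (MvPolynomial.coeff m) h
      rw [MvPolynomial.coeff_homogeneousComponent, if_pos hdeg'] at h1
      exact MvPolynomial.mem_support_iff.1 hm h1
    -- `w` is a multiple of one of the `z i`, and the `z i - c i • w` are one fewer in number
    obtain ⟨c, hc⟩ : ∃ c, MvPolynomial.eval c
        (MvPolynomial.homogeneousComponent P.totalDegree P) ≠ 0 := by
      by_contra! h
      exact hcomp (MvPolynomial.funext fun x => by rw [h x, map_zero])
    obtain ⟨j, hj⟩ : ∃ j, c j ≠ 0 := by
      by_contra! h
      obtain rfl : c = 0 := funext h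
      rw [MvPolynomial.eval_zero] at hc
      rw [MvPolynomial.constantCoeff_eq, MvPolynomial.coeff_homogeneousComponent] at hc
      split_ifs at hc with h0
      · rw [map_zero] at h0
        have hPC := MvPolynomial.totalDegree_eq_zero_iff_eq_C.1 h0.symm
        rw [hPC, MvPolynomial.aeval_C, map_eq_zero_iff _ (algebraMap K A).injective] at hP
        exact hc hP
      · exact hc rfl
    let w : A := (c j)⁻¹ • z j
    let z' : Fin (N + 1) → A := fun i => z i - c i • w
    have hzj : z' j = 0 := by simp [z', w, smul_smul, hj]
    obtain ⟨n, y, hy, hspan, hint⟩ := ih (z' ∘ j.succAbove)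
    have hz' : ∀ i, IsIntegral (reesAdjoin K 1 y) (Polynomial.monomial 1 (z' i)) := by
      intro i
      rcases Fin.eq_self_or_eq_succAbove j i with rfl | ⟨k, rfl⟩
      · rw [hzj, map_zero]
        exact isIntegral_zero
      · exact hint k
    have hw : IsIntegral (reesAdjoin K 1 y) (Polynomial.monomial 1 w) := by
      refine Subalgebra.isIntegral_of_forall_isIntegral (S₁ := reesAdjoin K 1 z') ?_ ?_
      · refine fun x hx => Algebra.isIntegral_of_mem_adjoin ?_ hx
        rintro _ (rfl | ⟨i, rfl⟩)
        · exact isIntegral_algebraMap (x := (⟨_, X_mem_reesAdjoin⟩ : reesAdjoin K 1 y))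
        · exact hz' i
      · have := isIntegral_mul_of_aeval_eq_zero (reesAdjoin K 1 z') X_mem_reesAdjoin
          (a := fun i => Polynomial.C (z' i))
          (fun i => by
            rw [Polynomial.X_mul_C, Polynomial.C_mul_X_eq_monomial]
            exact monomial_mem_reesAdjoin i)
          c (Polynomial.C w) P le_rfl hc ?_
        · rwa [Polynomial.X_mul_C, Polynomial.C_mul_X_eq_monomial] at this
        · have h1 : (fun i => Polynomial.C (z' i) + algebraMap K (Polynomial A) (c i) *
              Polynomial.C w) = algebraMap A (Polynomial A) ∘ z := by
            funext i
            rw [Function.comp_apply]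
            rw [IsScalarTower.algebraMap_apply K A (Polynomial A), Polynomial.algebraMap_eq,
              ← map_mul, ← map_add]
            simp [z', Algebra.smul_def]
          rw [h1, MvPolynomial.aeval_algebraMap_apply, hP, map_zero]
    refine ⟨n, y, hy, fun i => ?_, fun i => ?_⟩
    · refine Submodule.span_le.2 ?_ (hspan i)
      rintro _ ⟨k, rfl⟩
      exact sub_mem (Submodule.subset_span ⟨_, rfl⟩) (Submodule.smul_mem _ _
        (Submodule.smul_mem _ _ (Submodule.subset_span ⟨_, rfl⟩)))
    · have h : Polynomial.monomial 1 (z i) =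
          Polynomial.monomial 1 (z' i) + c i • Polynomial.monomial 1 w := by
        rw [Polynomial.smul_monomial, ← map_add]
        simp [z']
      rw [h]
      exact (hz' i).add (hw.smul (c i))

/-! ### Weighted degrees of factors of monic polynomials -/

section GaussLemma

variable {K σ : Type*} [Field K]

open Classical in
/-- The absolute value `2 ^ (e * deg p)` on a polynomial ring; its Gauss norms on the polynomial
ring in one more variable are multiplicative and measure weighted degrees. -/
noncomputable def degreeAbsoluteValue (K σ : Type*) [Field K] (e : ℕ) :
    AbsoluteValue (MvPolynomial σ K) ℝ where
  toFun p := if p = 0 then 0 else 2 ^ (e * p.totalDegree)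
  map_mul' p q := by
    by_cases hp : p = 0
    · simp [hp]
    by_cases hq : q = 0
    · simp [hq]
    rw [if_neg hp, if_neg hq, if_neg (mul_ne_zero hp hq),
      MvPolynomial.totalDegree_mul_of_isDomain hp hq, mul_add, pow_add]
  nonneg' p := by split_ifs <;> positivity
  eq_zero' p := by
    split_ifs with h
    · simp [h]
    · simp [h]
  add_le' p q := by
    by_cases hp : p = 0
    · simp [hp]
    by_cases hq : q = 0
    · simp [hq]
    rw [if_neg hp, if_neg hq]
    split_ifs with h
    · positivity
    · have h1 : (2 : ℝ) ^ (e * (p + q).totalDegree) ≤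
          2 ^ (e * max p.totalDegree q.totalDegree) :=
        pow_le_pow_right₀ one_le_two (Nat.mul_le_mul_left e (MvPolynomial.totalDegree_add p q))
      have hp2 : (0 : ℝ) < 2 ^ (e * p.totalDegree) := by positivity
      have hq2 : (0 : ℝ) < 2 ^ (e * q.totalDegree) := by positivity
      rcases le_total p.totalDegree q.totalDegree with h2 | h2
      · rw [max_eq_right h2] at h1
        linarith
      · rw [max_eq_left h2] at h1
        linarith

theorem degreeAbsoluteValue_apply (e : ℕ) {p : MvPolynomial σ K} (hp : p ≠ 0) :
    degreeAbsoluteValue K σ e p = 2 ^ (e * p.totalDegree) := if_neg hp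

theorem isNonarchimedean_degreeAbsoluteValue (e : ℕ) :
    IsNonarchimedean (degreeAbsoluteValue K σ e) := by
  intro p q
  by_cases hp : p = 0
  · simp [hp]
  by_cases hq : q = 0
  · simp [hq]
  by_cases h : p + q = 0
  · rw [h, map_zero]
    exact le_max_of_le_left (AbsoluteValue.nonneg _ _)
  rw [degreeAbsoluteValue_apply e hp, degreeAbsoluteValue_apply e hq,
    degreeAbsoluteValue_apply e h]
  have h1 : (2 : ℝ) ^ (e * (p + q).totalDegree) ≤
      2 ^ (e * max p.totalDegree q.totalDegree) :=
    pow_le_pow_right₀ one_le_two (Nat.mul_le_mul_left e (MvPolynomial.totalDegree_add p q))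
  rcases le_total p.totalDegree q.totalDegree with h2 | h2
  · rw [max_eq_right h2] at h1
    exact le_max_of_le_right h1
  · rw [max_eq_left h2] at h1
    exact le_max_of_le_left h1

/-- The monic polynomial `G` over `K[Y]` is of weighted degree `j * deg G`, when the `Y` have
weight `e` and the variable of `G` has weight `j`. -/
def HasSlopeLE (e j : ℕ) (G : Polynomial (MvPolynomial σ K)) : Prop :=
  ∀ i, G.coeff i ≠ 0 → e * (G.coeff i).totalDegree + i * j ≤ G.natDegree * j

/-- Weighted degrees are additive, and that of a monic polynomial is at least the weight of its
leading term; hence a monic factor of a polynomial of small slope has small slope. -/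
theorem HasSlopeLE.of_mul {e j : ℕ} {q h : Polynomial (MvPolynomial σ K)} (hq : q.Monic)
    (hh : h.Monic) (hqh : HasSlopeLE e j (q * h)) : HasSlopeLE e j q := by
  set v := degreeAbsoluteValue K σ e with hv
  have hc : (0 : ℝ) < 2 ^ j := by positivity
  have hG : (q * h).gaussNorm v (2 ^ j) ≤ ((2 : ℝ) ^ j) ^ (q * h).natDegree := by
    obtain ⟨i, hi⟩ := Polynomial.exists_eq_gaussNorm v (2 ^ j) (q * h)
    rw [hi]
    by_cases h0 : (q * h).coeff i = 0
    · rw [h0, map_zero, zero_mul]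
      positivity
    · rw [hv, degreeAbsoluteValue_apply e h0, ← pow_mul, ← pow_mul, ← pow_add]
      refine pow_le_pow_right₀ one_le_two ?_
      have := hqh i h0
      rwa [mul_comm j i, mul_comm j _]
  have hh' : ((2 : ℝ) ^ j) ^ h.natDegree ≤ h.gaussNorm v (2 ^ j) := by
    have := h.le_gaussNorm v hc.le h.natDegree
    rwa [Polynomial.coeff_natDegree, hh, map_one, one_mul] at this
  have hq' : q.gaussNorm v (2 ^ j) ≤ ((2 : ℝ) ^ j) ^ q.natDegree := by
    rw [Polynomial.gaussNorm_mul (isNonarchimedean_degreeAbsoluteValue e) hc,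
      hq.natDegree_mul hh, pow_add] at hG
    have hpos : (0 : ℝ) < ((2 : ℝ) ^ j) ^ h.natDegree := by positivity
    have := (mul_le_mul_of_nonneg_left hh' (q.gaussNorm_nonneg v hc.le)).trans hG
    exact le_of_mul_le_mul_right this hpos
  intro i hi
  have h1 := (q.le_gaussNorm v hc.le i).trans hq'
  rw [hv, degreeAbsoluteValue_apply e hi, ← pow_mul, ← pow_mul, ← pow_add] at h1
  have h2 := (pow_le_pow_iff_right₀ (one_lt_two : (1 : ℝ) < 2)).1 h1
  rwa [mul_comm j i, mul_comm j _] at h2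

end GaussLemma

/-! ### The filtration by integral elements -/

section IntegralFiltration

variable {K A : Type*} [Field K] [CommRing A] [Algebra K A] {ι : Type*}

theorem Subalgebra.isIntegral_map {C D : Type*} [CommRing C] [CommRing D] [Algebra K C]
    [Algebra K D] {S : Subalgebra K C} {S' : Subalgebra K D} (g : C →ₐ[K] D)
    (hg : ∀ x ∈ S, g x ∈ S') {x : C} (hx : IsIntegral S x) : IsIntegral S' (g x) := by
  let g' : S →+* S' := (g.comp S.val).toRingHom.codRestrict S' fun a => hg a a.2
  obtain ⟨p, hp, hpx⟩ := hx
  refine ⟨p.map g', hp.map g', ?_⟩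
  rw [Polynomial.eval₂_map]
  have h := congrArg g hpx
  rw [map_zero] at h
  rw [← h]
  exact (Polynomial.hom_eval₂ p (algebraMap S C) g.toRingHom x).symm

/-- The elements `f` of `A` for which `f s^d` is integral over `K[s, s^e y₁, …, s^e yₙ]`. -/
noncomputable def integralFiltration (K : Type*) {A ι : Type*} [Field K] [CommRing A] [Algebra K A]
    (e : ℕ) (y : ι → A) (d : ℕ) : Submodule K A where
  carrier := {f | IsIntegral (reesAdjoin K e y) (Polynomial.monomial d f)}
  zero_mem' := by
    rw [Set.mem_ofPred_eq, map_zero]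
    exact isIntegral_zero
  add_mem' hf hg := by
    rw [Set.mem_ofPred_eq, map_add]
    exact IsIntegral.add hf hg
  smul_mem' c f hf := by
    rw [Set.mem_ofPred_eq, ← Polynomial.smul_monomial]
    exact IsIntegral.smul c hf

variable {e : ℕ} {y : ι → A}

theorem mem_integralFiltration {d : ℕ} {f : A} :
    f ∈ integralFiltration K e y d ↔
      IsIntegral (reesAdjoin K e y) (Polynomial.monomial d f) := Iff.rfl

theorem isIntegral_of_mem_reesAdjoin {p : Polynomial A} (h : p ∈ reesAdjoin K e y) :
    IsIntegral (reesAdjoin K e y) p :=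
  isIntegral_algebraMap (x := (⟨p, h⟩ : reesAdjoin K e y))

theorem one_mem_integralFiltration : (1 : A) ∈ integralFiltration K e y 0 := by
  rw [mem_integralFiltration, Polynomial.monomial_zero_one]
  exact isIntegral_one

theorem mul_mem_integralFiltration (d d' : ℕ) (f g : A) (hf : f ∈ integralFiltration K e y d)
    (hg : g ∈ integralFiltration K e y d') : f * g ∈ integralFiltration K e y (d + d') := by
  rw [mem_integralFiltration, ← Polynomial.monomial_mul_monomial]
  exact IsIntegral.mul hf hg

theorem integralFiltration_mono : Monotone (integralFiltration K e y) := by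
  refine monotone_nat_of_le_succ fun d f hf => ?_
  rw [mem_integralFiltration, ← Polynomial.monomial_mul_X]
  exact IsIntegral.mul hf (isIntegral_of_mem_reesAdjoin X_mem_reesAdjoin)

theorem reesAdjoin_le_of_mem (S : Subalgebra K (Polynomial A)) (hX : Polynomial.X ∈ S)
    (hy : ∀ i, Polynomial.monomial e (y i) ∈ S) : reesAdjoin K e y ≤ S := by
  refine Algebra.adjoin_le ?_
  rintro _ (rfl | ⟨i, rfl⟩)
  · exact hX
  · exact hy i

theorem expand_mem_reesAdjoin (k : ℕ) {p : Polynomial A} (hp : p ∈ reesAdjoin K e y) :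
    (Polynomial.expand A k).restrictScalars K p ∈ reesAdjoin K (e * k) y := by
  refine reesAdjoin_le_of_mem
    ((reesAdjoin K (e * k) y).comap ((Polynomial.expand A k).restrictScalars K)) ?_ ?_ hp
  · change Polynomial.expand A k Polynomial.X ∈ reesAdjoin K (e * k) y
    rw [Polynomial.expand_X]
    exact pow_mem X_mem_reesAdjoin k
  · intro i
    change Polynomial.expand A k (Polynomial.monomial e (y i)) ∈ reesAdjoin K (e * k) y
    rw [Polynomial.expand_monomial]
    exact monomial_mem_reesAdjoin i

theorem isIntegral_expand (k : ℕ) {d : ℕ} {f : A} (hf : f ∈ integralFiltration K e y d) :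
    f ∈ integralFiltration K (e * k) y (d * k) := by
  have h := Subalgebra.isIntegral_map ((Polynomial.expand A k).restrictScalars K)
    (fun _ hx => expand_mem_reesAdjoin k hx) hf
  change IsIntegral _ (Polynomial.expand A k (Polynomial.monomial d f)) at h
  rwa [Polynomial.expand_monomial] at h

/-- If `f^k` has degree at most `d`, then `f` has degree at most `d / k`; the denominator is
removed by scaling the weights by `k`. -/
theorem mem_integralFiltration_of_pow_mem {k d : ℕ} (hk : 0 < k) {f : A}
    (hf : f ^ k ∈ integralFiltration K e y d) : f ∈ integralFiltration K (e * k) y d := by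
  have h := isIntegral_expand k hf
  rw [mem_integralFiltration, ← Polynomial.monomial_pow] at h
  exact IsIntegral.of_pow hk h

theorem mem_range_algebraMap_of_isIntegral_bot {C : Type*} [CommRing C] [IsDomain C] [Algebra K C]
    [IsAlgClosed K] {x : C} (h : IsIntegral (⊥ : Subalgebra K C) x) :
    x ∈ LinearMap.range (Algebra.linearMap K C) := by
  have : Algebra.IsIntegral K (⊥ : Subalgebra K C) :=
    ⟨fun x => by
      obtain ⟨c, hc⟩ := Algebra.mem_bot.1 x.2
      obtain rfl : algebraMap K (⊥ : Subalgebra K C) c = x := Subtype.ext hc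
      exact isIntegral_algebraMap⟩
  have hint : IsIntegral K x := isIntegral_trans x h
  exact minpoly.mem_range_of_degree_eq_one K x
    (IsAlgClosed.degree_eq_one_of_irreducible K (minpoly.irreducible hint))

/-- Setting `s = 0` shows that elements of degree zero are integral over `K`. -/
theorem mem_range_algebraMap_of_mem_integralFiltration_zero [IsAlgClosed K] [IsDomain A]
    (he : 0 < e) {f : A} (hf : f ∈ integralFiltration K e y 0) :
    f ∈ LinearMap.range (Algebra.linearMap K A) := by
  let g : Polynomial A →ₐ[K] A := (Polynomial.aeval (0 : A)).restrictScalars K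
  have hle : reesAdjoin K e y ≤ (⊥ : Subalgebra K A).comap g := by
    refine reesAdjoin_le_of_mem _ ?_ fun i => ?_
    · change Polynomial.aeval (0 : A) Polynomial.X ∈ (⊥ : Subalgebra K A)
      rw [Polynomial.aeval_X]
      exact zero_mem _
    · change Polynomial.aeval (0 : A) (Polynomial.monomial e (y i)) ∈ (⊥ : Subalgebra K A)
      rw [Polynomial.aeval_monomial, zero_pow he.ne', mul_zero]
      exact zero_mem _
  have h := Subalgebra.isIntegral_map (S' := ⊥) g (fun x hx => hle hx) hf
  have hgf : g (Polynomial.monomial 0 f) = f := by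
    change Polynomial.aeval (0 : A) (Polynomial.monomial 0 f) = f
    simp
  rw [hgf] at h
  exact mem_range_algebraMap_of_isIntegral_bot h

theorem exists_mem_integralFiltration {κ : Type*} {z : κ → A}
    (hz : Algebra.adjoin K (Set.range z) = ⊤)
    (hzint : ∀ j, IsIntegral (reesAdjoin K 1 y) (Polynomial.monomial 1 (z j))) (f : A) :
    ∃ d, f ∈ integralFiltration K e y d := by
  have hf : f ∈ Algebra.adjoin K (Set.range z) := hz ▸ Algebra.mem_top
  induction hf using Algebra.adjoin_induction with
  | mem x hx =>
    obtain ⟨j, rfl⟩ := hx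
    have h1 : z j ∈ integralFiltration K 1 y 1 := hzint j
    have h2 := isIntegral_expand e h1
    rw [one_mul] at h2
    exact ⟨e, h2⟩
  | algebraMap c =>
    refine ⟨0, ?_⟩
    rw [Algebra.algebraMap_eq_smul_one]
    exact Submodule.smul_mem _ c one_mem_integralFiltration
  | add x y _ _ hx hy =>
    obtain ⟨a, ha⟩ := hx
    obtain ⟨b, hb⟩ := hy
    exact ⟨max a b, add_mem (integralFiltration_mono (le_max_left a b) ha)
      (integralFiltration_mono (le_max_right a b) hb)⟩
  | mul x y _ _ hx hy =>
    obtain ⟨a, ha⟩ := hx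
    obtain ⟨b, hb⟩ := hy
    exact ⟨a + b, mul_mem_integralFiltration a b _ _ ha hb⟩

end IntegralFiltration

/-! ### Integral elements and slopes of minimal polynomials -/

section Slope

variable {K A ι : Type*} [Field K] [CommRing A] [Algebra K A] {e : ℕ} {y : ι → A}

theorem monomial_aeval_mem_reesAdjoin {l : ℕ} (r : MvPolynomial ι K)
    (hr : e * r.totalDegree ≤ l) :
    Polynomial.monomial l (MvPolynomial.aeval y r) ∈ reesAdjoin K e y := by
  rw [MvPolynomial.aeval_def, MvPolynomial.eval₂_eq, map_sum]
  refine sum_mem fun m hm => ?_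
  have hml : e * ∑ i ∈ m.support, m i ≤ l :=
    (Nat.mul_le_mul_left e (MvPolynomial.le_totalDegree hm)).trans hr
  have h1 : ∏ i ∈ m.support, Polynomial.monomial e (y i) ^ m i =
      Polynomial.monomial (e * ∑ i ∈ m.support, m i) (∏ i ∈ m.support, y i ^ m i) := by
    simp only [← Polynomial.C_mul_X_pow_eq_monomial, mul_pow, ← pow_mul,
      Finset.prod_mul_distrib, Finset.prod_pow_eq_pow_sum, Finset.mul_sum, map_prod, map_pow]
  have h2 : Polynomial.monomial l (algebraMap K A (r.coeff m) * ∏ i ∈ m.support, y i ^ m i) =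
      r.coeff m • (Polynomial.X ^ (l - e * ∑ i ∈ m.support, m i) *
        ∏ i ∈ m.support, Polynomial.monomial e (y i) ^ m i) := by
    rw [h1, Polynomial.X_pow_mul_monomial, Nat.add_sub_cancel' hml, Polynomial.smul_monomial,
      Algebra.smul_def]
  rw [h2]
  exact Subalgebra.smul_mem _ (mul_mem (pow_mem X_mem_reesAdjoin _)
    (prod_mem fun i _ => pow_mem (monomial_mem_reesAdjoin i) _)) _

/-- The coefficient of `s^l` in an element of `K[s, s^e y₁, …, s^e yₙ]` is a polynomial in the `yᵢ`
of degree at most `l / e`. -/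
theorem exists_aeval_eq_coeff_of_mem_reesAdjoin {p : Polynomial A} (hp : p ∈ reesAdjoin K e y)
    (l : ℕ) : ∃ r : MvPolynomial ι K, MvPolynomial.aeval y r = p.coeff l ∧
      e * r.totalDegree ≤ l := by
  classical
  unfold reesAdjoin at hp
  induction hp using Algebra.adjoin_induction generalizing l with
  | mem x hx =>
    obtain rfl | ⟨i, rfl⟩ := hx
    · rw [Polynomial.coeff_X]
      split_ifs
      · exact ⟨1, map_one _, by simp⟩
      · exact ⟨0, map_zero _, by simp⟩
    · rw [Polynomial.coeff_monomial]
      split_ifs with h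
      · exact ⟨MvPolynomial.X i, MvPolynomial.aeval_X _ _, by simp [h]⟩
      · exact ⟨0, map_zero _, by simp⟩
  | algebraMap c =>
    rw [IsScalarTower.algebraMap_apply K A (Polynomial A), Polynomial.algebraMap_eq,
      Polynomial.coeff_C]
    split_ifs
    · exact ⟨MvPolynomial.C c, MvPolynomial.aeval_C _ _, by simp⟩
    · exact ⟨0, map_zero _, by simp⟩
  | add p q _ _ hp hq =>
    obtain ⟨a, ha, ha'⟩ := hp l
    obtain ⟨b, hb, hb'⟩ := hq l
    refine ⟨a + b, by rw [map_add, ha, hb, Polynomial.coeff_add], ?_⟩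
    refine (Nat.mul_le_mul_left e (MvPolynomial.totalDegree_add a b)).trans ?_
    rcases le_total a.totalDegree b.totalDegree with h | h
    · rwa [max_eq_right h]
    · rwa [max_eq_left h]
  | mul p q _ _ hp hq =>
    choose a ha ha' using hp
    choose b hb hb' using hq
    refine ⟨∑ x ∈ Finset.HasAntidiagonal.antidiagonal l, a x.1 * b x.2, ?_, ?_⟩
    · rw [map_sum, Polynomial.coeff_mul]
      exact Finset.sum_congr rfl fun x _ => by rw [map_mul, ha, hb]
    · rcases Nat.eq_zero_or_pos e with rfl | he
      · simp
      rw [mul_comm, ← Nat.le_div_iff_mul_le he]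
      refine MvPolynomial.totalDegree_finsetSum_le fun x hx => ?_
      rw [Nat.le_div_iff_mul_le he, mul_comm]
      refine (Nat.mul_le_mul_left e (MvPolynomial.totalDegree_mul _ _)).trans ?_
      rw [mul_add, ← Finset.HasAntidiagonal.mem_antidiagonal.1 hx]
      exact add_le_add (ha' _) (hb' _)

/-- The coefficient of the right power of `s` in an integral equation of `f s^j` is an equation of
`f`, with coefficients of bounded degree. -/
theorem exists_monic_hasSlopeLE {j : ℕ} {f : A} (hf : f ∈ integralFiltration K e y j) :
    ∃ G : Polynomial (MvPolynomial ι K), G.Monic ∧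
      G.eval₂ (MvPolynomial.aeval y : MvPolynomial ι K →ₐ[K] A).toRingHom f = 0 ∧
      HasSlopeLE e j G := by
  obtain ⟨P, hP, hPf⟩ := hf
  have hr : ∀ i, ∃ r : MvPolynomial ι K,
      MvPolynomial.aeval y r = (P.coeff i : Polynomial A).coeff ((P.natDegree - i) * j) ∧
        e * r.totalDegree ≤ (P.natDegree - i) * j :=
    fun i => exists_aeval_eq_coeff_of_mem_reesAdjoin (P.coeff i).2 _
  choose r hr hr' using hr
  let lower : Polynomial (MvPolynomial ι K) :=
    ∑ i ∈ Finset.range P.natDegree, Polynomial.C (r i) * Polynomial.X ^ i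
  have hlow : lower.degree < (P.natDegree : WithBot ℕ) := by
    refine (Polynomial.degree_lt_iff_coeff_zero _ _).2 fun m hm => ?_
    rw [Polynomial.finsetSum_coeff]
    refine Finset.sum_eq_zero fun i hi => ?_
    rw [Polynomial.coeff_C_mul_X_pow, if_neg (by rw [Finset.mem_range] at hi; lia)]
  have hmonic : (Polynomial.X ^ P.natDegree + lower).Monic :=
    Polynomial.monic_X_pow_add hlow
  have hdeg : (Polynomial.X ^ P.natDegree + lower).natDegree = P.natDegree := by
    refine Polynomial.natDegree_eq_of_degree_eq_some ?_
    rw [Polynomial.degree_add_eq_left_of_degree_lt (by rwa [Polynomial.degree_X_pow]),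
      Polynomial.degree_X_pow]
  refine ⟨Polynomial.X ^ P.natDegree + lower, hmonic, ?_, ?_⟩
  · -- compare the coefficients of `s ^ (j * deg P)` in the integral equation of `f s ^ j`
    have h0 := hPf
    rw [hP.as_sum] at h0
    have h1 := congrArg (fun p : Polynomial A => p.coeff (P.natDegree * j)) h0
    simp only [Polynomial.eval₂_add, Polynomial.eval₂_pow, Polynomial.eval₂_X,
      Polynomial.eval₂_finsetSum, Polynomial.eval₂_mul, Polynomial.eval₂_C,
      Polynomial.coeff_add, Polynomial.coeff_zero, Polynomial.monomial_pow,
      Polynomial.finsetSum_coeff] at h1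
    rw [Polynomial.coeff_monomial, if_pos (mul_comm _ _)] at h1
    simp only [lower, Polynomial.eval₂_add, Polynomial.eval₂_pow, Polynomial.eval₂_X,
      Polynomial.eval₂_finsetSum, Polynomial.eval₂_mul, Polynomial.eval₂_C]
    rw [← h1]
    congr 1
    refine Finset.sum_congr rfl fun i hi => ?_
    have hsplit : P.natDegree * j = (P.natDegree - i) * j + j * i := by
      rw [mul_comm j i, ← add_mul, Nat.sub_add_cancel (Finset.mem_range.1 hi).le]
    rw [hsplit, Polynomial.coeff_mul_monomial]
    congr 1
    exact hr i
  · intro i hi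
    rw [hdeg]
    have hile : i ≤ P.natDegree := hdeg ▸ Polynomial.le_natDegree_of_ne_zero hi
    rcases hile.lt_or_eq with h | rfl
    · have hci : (Polynomial.X ^ P.natDegree + lower).coeff i = r i := by
        rw [Polynomial.coeff_add, Polynomial.coeff_X_pow, if_neg h.ne, zero_add,
          Polynomial.finsetSum_coeff, Finset.sum_eq_single i]
        · rw [Polynomial.coeff_C_mul_X_pow, if_pos rfl]
        · intro k _ hk
          rw [Polynomial.coeff_C_mul_X_pow, if_neg hk.symm]
        · intro h2
          exact absurd (Finset.mem_range.2 h) h2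
      rw [hci]
      refine (Nat.add_le_add_right (hr' i) _).trans ?_
      rw [← add_mul, Nat.sub_add_cancel hile]
    · have h1 : (Polynomial.X ^ P.natDegree + lower).coeff P.natDegree = 1 := by
        have := hmonic.coeff_natDegree
        rwa [hdeg] at this
      rw [h1, MvPolynomial.totalDegree_one, mul_zero, zero_add]

/-- The converse of `exists_monic_hasSlopeLE`: an equation of `f` of slope at most `j` homogenizes
to an integral equation of `f s^j`. -/
theorem mem_integralFiltration_of_hasSlopeLE {j : ℕ} {f : A} {G : Polynomial (MvPolynomial ι K)}
    (hG : G.Monic)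
    (hGf : G.eval₂ (MvPolynomial.aeval y : MvPolynomial ι K →ₐ[K] A).toRingHom f = 0)
    (hslope : HasSlopeLE e j G) : f ∈ integralFiltration K e y j := by
  have hmem : ∀ i, Polynomial.monomial ((G.natDegree - i) * j)
      (MvPolynomial.aeval y (G.coeff i)) ∈ reesAdjoin K e y := by
    intro i
    by_cases h : G.coeff i = 0
    · rw [h, map_zero, map_zero]
      exact zero_mem _
    · refine monomial_aeval_mem_reesAdjoin _ ?_
      have h1 := hslope i h
      rw [Nat.sub_mul]
      exact Nat.le_sub_of_add_le h1
  let P : Polynomial (reesAdjoin K e y) := Polynomial.X ^ G.natDegree +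
    ∑ i ∈ Finset.range G.natDegree, Polynomial.C ⟨_, hmem i⟩ * Polynomial.X ^ i
  have hP : P.Monic := by
    refine Polynomial.monic_X_pow_add ?_
    refine (Polynomial.degree_lt_iff_coeff_zero _ _).2 fun m hm => ?_
    rw [Polynomial.finsetSum_coeff]
    refine Finset.sum_eq_zero fun i hi => ?_
    rw [Polynomial.coeff_C_mul_X_pow, if_neg (by rw [Finset.mem_range] at hi; lia)]
  refine ⟨P, hP, ?_⟩
  have h1 : P.eval₂ (algebraMap (reesAdjoin K e y) (Polynomial A)) (Polynomial.monomial j f) =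
      Polynomial.monomial (G.natDegree * j)
        (G.eval₂ (MvPolynomial.aeval y : MvPolynomial ι K →ₐ[K] A).toRingHom f) := by
    have hGs : G.eval₂ (MvPolynomial.aeval y : MvPolynomial ι K →ₐ[K] A).toRingHom f =
        f ^ G.natDegree + ∑ i ∈ Finset.range G.natDegree,
          MvPolynomial.aeval y (G.coeff i) * f ^ i := by
      conv_lhs => rw [hG.as_sum]
      simp only [Polynomial.eval₂_add, Polynomial.eval₂_pow, Polynomial.eval₂_X,
        Polynomial.eval₂_finsetSum, Polynomial.eval₂_mul, Polynomial.eval₂_C]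
      rfl
    rw [hGs]
    simp only [P, Polynomial.eval₂_add, Polynomial.eval₂_pow, Polynomial.eval₂_X,
      Polynomial.eval₂_finsetSum, Polynomial.eval₂_mul, Polynomial.eval₂_C, map_add, map_sum,
      Polynomial.monomial_pow]
    refine congrArg₂ (· + ·) (by rw [mul_comm]) (Finset.sum_congr rfl fun i hi => ?_)
    have hsplit : G.natDegree * j = (G.natDegree - i) * j + j * i := by
      rw [mul_comm j i, ← add_mul, Nat.sub_add_cancel (Finset.mem_range.1 hi).le]
    rw [hsplit, ← Polynomial.monomial_mul_monomial]
    rfl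
  rw [h1, hGf, map_zero]

/-- If the degrees of minimal polynomials over `K[y]` are at most `M`, then the weight `M!` clears
all denominators: a power `f ^ k` of degree less than `k (d + 1)` forces `f` to have degree at
most `d`. -/
theorem mem_integralFiltration_of_pow_mem_of_lt [IsDomain A]
    (hy : AlgebraicIndependent K y) {M : ℕ}
    (hM : ∀ f : A, ∃ G : Polynomial (MvPolynomial ι K), G.Monic ∧ G.natDegree ≤ M ∧
      G.eval₂ (MvPolynomial.aeval y : MvPolynomial ι K →ₐ[K] A).toRingHom f = 0)
    {k j d : ℕ} (hk : 0 < k) (hj : j < k * (d + 1)) {f : A}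
    (hf : f ^ k ∈ integralFiltration K M.factorial y j) :
    f ∈ integralFiltration K M.factorial y d := by
  obtain ⟨G, hG, hGf, hslope⟩ := exists_monic_hasSlopeLE (mem_integralFiltration_of_pow_mem hk hf)
  let := (MvPolynomial.aeval y : MvPolynomial ι K →ₐ[K] A).toRingHom.toAlgebra
  have hinj : Function.Injective (algebraMap (MvPolynomial ι K) A) := hy
  have : FaithfulSMul (MvPolynomial ι K) A := (faithfulSMul_iff_algebraMap_injective _ _).2 hinj
  have hint : IsIntegral (MvPolynomial ι K) f := ⟨G, hG, hGf⟩
  obtain ⟨h, hqh⟩ := minpoly.isIntegrallyClosed_dvd hint hGf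
  obtain ⟨G', hG', hM', hGf'⟩ := hM f
  have hdegM : (minpoly (MvPolynomial ι K) f).natDegree ≤ M :=
    (Polynomial.natDegree_le_of_dvd (minpoly.isIntegrallyClosed_dvd hint hGf') hG'.ne_zero).trans
      hM'
  have hq := minpoly.monic hint
  rw [hqh] at hG hslope
  have hslope' := HasSlopeLE.of_mul hq (hq.of_mul_monic_left hG) hslope
  refine mem_integralFiltration_of_hasSlopeLE hq (minpoly.aeval _ f) ?_
  intro i hi
  have h1 := hslope' i hi
  generalize minpoly (MvPolynomial ι K) f = q at *
  have hile : i ≤ q.natDegree := Polynomial.le_natDegree_of_ne_zero hi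
  rcases hile.lt_or_eq with hlt | rfl
  · -- the distance `a + 1` from `i` to the degree of `q` divides `M!`, so the degree bound
    -- for the `i`-th coefficient is an inequality between integers and can be rounded down
    obtain ⟨a, ha⟩ := Nat.exists_eq_add_of_lt hlt
    obtain ⟨e', he'⟩ : a + 1 ∣ M.factorial := Nat.dvd_factorial (Nat.succ_pos a) (by lia)
    have hqd : q.natDegree = i + (a + 1) := ha
    rw [he', hqd] at h1
    rw [he', hqd]
    generalize (q.coeff i).totalDegree = D at *
    have h2 : (a + 1) * (e' * k * D) ≤ (a + 1) * j := by nlinarith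
    have h3 : e' * k * D ≤ j := Nat.le_of_mul_le_mul_left h2 (Nat.succ_pos a)
    have h4 : k * (e' * D) < k * (d + 1) := by
      calc k * (e' * D) = e' * k * D := by ring
        _ ≤ j := h3
        _ < _ := hj
    have h5 : e' * D ≤ d := Nat.lt_succ_iff.1 (Nat.lt_of_mul_lt_mul_left h4)
    have h6 := Nat.mul_le_mul_left (a + 1) h5
    nlinarith
  · rw [hq.coeff_natDegree, MvPolynomial.totalDegree_one, mul_zero, zero_add]

end Slope

/-! ### Finiteness of the graded ring -/

section Finiteness

variable {K A : Type*} [Field K] [CommRing A] [IsDomain A] [Algebra K A] {n e : ℕ} {y : Fin n → A}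

theorem isAlgebraic_reesAdjoin (h : ∀ f, ∃ d, f ∈ integralFiltration K e y d) :
    Algebra.IsAlgebraic (reesAdjoin K e y) (Polynomial A) := by
  have hX : IsAlgebraic (reesAdjoin K e y) (Polynomial.X : Polynomial A) :=
    (isIntegral_of_mem_reesAdjoin X_mem_reesAdjoin).isAlgebraic
  have hC : ∀ a : A, IsAlgebraic (reesAdjoin K e y) (Polynomial.C a) := fun a => by
    obtain ⟨d, hd⟩ := h a
    have h1 : IsAlgebraic (reesAdjoin K e y) (Polynomial.monomial d a) :=
      IsIntegral.isAlgebraic hd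
    rw [← Polynomial.C_mul_X_pow_eq_monomial, mul_comm] at h1
    exact IsAlgebraic.of_mul
      (mem_nonZeroDivisors_of_ne_zero (pow_ne_zero d Polynomial.X_ne_zero)) (hX.pow d) h1
  refine ⟨fun p => ?_⟩
  induction p using Polynomial.induction_on' with
  | add p q hp hq => exact hp.add hq
  | monomial d a =>
    rw [← Polynomial.C_mul_X_pow_eq_monomial]
    exact (hC a).mul (hX.pow d)

omit [IsDomain A] in
theorem reesAdjoin_eq_adjoin_range :
    reesAdjoin K e y = Algebra.adjoin K (Set.range fun i : Option (Fin n) =>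
      i.elim (Polynomial.X : Polynomial A) fun i => Polynomial.monomial e (y i)) := by
  rw [reesAdjoin]
  congr 1
  ext p
  simp [Option.exists, eq_comm]

/-- Counting transcendence degrees: `A[s]` is algebraic over `K[s, s^e y₁, …, s^e yₙ]` and has
transcendence degree at least `n + 1`. -/
theorem algebraicIndependent_reesAdjoin (hy : AlgebraicIndependent K y)
    (h : ∀ f, ∃ d, f ∈ integralFiltration K e y d) :
    AlgebraicIndependent K fun i : Option (Fin n) =>
      i.elim (Polynomial.X : Polynomial A) fun i => Polynomial.monomial e (y i) := by
  have halg := isAlgebraic_reesAdjoin h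
  rw [reesAdjoin_eq_adjoin_range] at halg
  refine (Algebra.IsAlgebraic.isTranscendenceBasis_of_lift_le_trdeg_of_finite K _ ?_).1
  rw [← trdeg_add_eq K A (A := Polynomial A), Polynomial.trdeg_of_isDomain]
  have h1 := hy.lift_cardinalMk_le_trdeg
  simp only [Cardinal.mk_fin, Cardinal.lift_natCast] at h1
  simp only [Cardinal.mk_option, Cardinal.mk_fin]
  simpa using h1

theorem isIntegrallyClosed_reesAdjoin (hy : AlgebraicIndependent K y)
    (h : ∀ f, ∃ d, f ∈ integralFiltration K e y d) : IsIntegrallyClosed (reesAdjoin K e y) := by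
  rw [reesAdjoin_eq_adjoin_range]
  exact IsIntegrallyClosed.of_equiv
    (algebraicIndependent_reesAdjoin hy h).aevalEquiv.toRingEquiv

omit [IsDomain A] in
theorem finiteType_reesAdjoin : Algebra.FiniteType K (reesAdjoin K e y) := by
  rw [← Subalgebra.fg_iff_finiteType]
  exact Subalgebra.fg_def.2 ⟨_, (Set.finite_range _).insert _, rfl⟩

/-- The graded ring of the filtration by integral elements is a submodule of an integral closure,
which is a finite module over a polynomial ring. -/
theorem finiteType_of_isIntegral_reesAdjoin [PerfectField K] [Algebra.FiniteType K A]
    (hy : AlgebraicIndependent K y)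
    (h : ∀ f, ∃ d, f ∈ integralFiltration K e y d) (S : Subalgebra K (Polynomial A))
    (hle : reesAdjoin K e y ≤ S) (hint : ∀ x ∈ S, IsIntegral (reesAdjoin K e y) x) :
    Algebra.FiniteType K S := by
  have h1 := isIntegrallyClosed_reesAdjoin hy h
  have h2 : Algebra.FiniteType K (reesAdjoin K e y) := finiteType_reesAdjoin
  have h3 := isAlgebraic_reesAdjoin h
  have h4 : Algebra.FiniteType K (Polynomial A) :=
    Algebra.FiniteType.trans (S := A) ‹_› inferInstance
  have h5 : Algebra.FiniteType (reesAdjoin K e y) (Polynomial A) :=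
    Algebra.FiniteType.of_restrictScalars_finiteType K _ _
  have h6 := finite_integralClosure_of_isAlgebraic K (reesAdjoin K e y) (Polynomial A)
  have h7 : IsNoetherianRing (reesAdjoin K e y) := Algebra.FiniteType.isNoetherianRing K _
  have h8 : IsNoetherian (reesAdjoin K e y) (integralClosure (reesAdjoin K e y) (Polynomial A)) :=
    isNoetherian_of_isNoetherianRing_of_finite (reesAdjoin K e y)
      (integralClosure (reesAdjoin K e y) (Polynomial A))
  let := (Subalgebra.inclusion hle).toRingHom.toAlgebra
  have : IsScalarTower K (reesAdjoin K e y) S := IsScalarTower.of_algebraMap_eq fun _ => rfl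
  let θ : S →ₐ[reesAdjoin K e y] integralClosure (reesAdjoin K e y) (Polynomial A) :=
    { (S.val.toRingHom.codRestrict (integralClosure (reesAdjoin K e y) (Polynomial A))
        fun x => hint x x.2) with
      commutes' := fun _ => rfl }
  have h9 : Module.Finite (reesAdjoin K e y) S :=
    Module.Finite.of_injective θ.toLinearMap fun a b hab =>
      Subtype.ext (congrArg (fun x : integralClosure (reesAdjoin K e y) (Polynomial A) =>
        (x : Polynomial A)) hab)
  exact Algebra.FiniteType.trans (S := reesAdjoin K e y) h2 inferInstance

end Finiteness

/-! ### Completions with prescribed elements of equal degree -/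

/-- An algebra homomorphism to a domain which is scalar on `S` is scalar on every element integral
over `S`. -/
theorem exists_algebraMap_eq_of_isIntegral {K D Q : Type*} [Field K] [IsAlgClosed K] [CommRing D]
    [CommRing Q] [IsDomain Q] [Algebra K D] [Algebra K Q] {S G : Subalgebra K D} (hle : S ≤ G)
    (π : G →ₐ[K] Q) (hbot : ∀ a : S, π (Subalgebra.inclusion hle a) ∈ (⊥ : Subalgebra K Q))
    (x : G) (hx : _root_.IsIntegral S (x : D)) : ∃ c : K, π x = algebraMap K Q c := by
  let ρ : S →+* (⊥ : Subalgebra K Q) :=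
    (π.comp (Subalgebra.inclusion hle)).toRingHom.codRestrict _ hbot
  obtain ⟨p, hp, hpx⟩ := hx
  have h1 : p.eval₂ (Subalgebra.inclusion hle).toRingHom x = 0 := by
    refine Subtype.ext ?_
    refine Eq.trans ?_ hpx
    exact Polynomial.hom_eval₂ p _ G.val.toRingHom x
  have h2 : _root_.IsIntegral (⊥ : Subalgebra K Q) (π x) := by
    refine ⟨p.map ρ, hp.map ρ, ?_⟩
    rw [Polynomial.eval₂_map]
    have h3 := congrArg π h1
    rw [map_zero] at h3
    rw [← h3]
    exact (Polynomial.hom_eval₂ p _ π.toRingHom x).symm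
  obtain ⟨c, hc⟩ := mem_range_algebraMap_of_isIntegral_bot h2
  exact ⟨c, hc.symm⟩

theorem HomogeneousIdeal.mem_of_sub_algebraMap_mem {K R : Type*} [CommRing K] [CommRing R]
    [Algebra K R] {𝒜 : ℕ → Submodule K R} [GradedAlgebra 𝒜] (P : HomogeneousIdeal 𝒜) {d : ℕ}
    (hd : 0 < d) {x : R} (hx : x ∈ 𝒜 d) {c : K} (hc : x - algebraMap K R c ∈ P.toIdeal) :
    x ∈ P.toIdeal := by
  have h1 := P.isHomogeneous d hc
  rwa [DirectSum.decompose_sub, DirectSum.sub_apply, AddSubgroupClass.coe_sub,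
    DirectSum.decompose_of_mem_same 𝒜 hx,
    DirectSum.decompose_of_mem_ne 𝒜 (SetLike.algebraMap_mem_graded 𝒜 c) hd.ne,
    sub_zero] at h1

namespace DegreeLike

section

variable {K A : Type*} [Field K] [CommRing A] [Algebra K A] (δ : DegreeLike K A)

/-- The elements `w` of `F_e` whose homogenization `(w)_e` vanishes at `P`. -/
def vanishingPart (P : Ideal δ.gradedRing) (e : ℕ) : Submodule K A where
  carrier := {w | ∃ h : w ∈ δ.filtration e, δ.homog e w h ∈ P}
  zero_mem' := ⟨zero_mem _, by rw [homog_zero]; exact zero_mem _⟩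
  add_mem' := fun ⟨hf, hf'⟩ ⟨hg, hg'⟩ =>
    ⟨add_mem hf hg, by rw [homog_add δ hf hg]; exact add_mem hf' hg'⟩
  smul_mem' c _ := fun ⟨hf, hf'⟩ => ⟨Submodule.smul_mem _ c hf, by
    rw [homog_smul δ c hf, Algebra.smul_def]
    exact P.mul_mem_left _ hf'⟩

variable {δ} {e : ℕ} {n : ℕ} {y : Fin n → A}

theorem le_gradedRing_of_filtration_eq
    (hfil : ∀ d : ℕ, δ.filtration d = integralFiltration K e y d) :
    reesAdjoin K e y ≤ δ.gradedRing := by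
  refine reesAdjoin_le_of_mem _ δ.t.2 fun i => δ.monomial_mem_gradedRing e ?_
  rw [hfil]
  exact isIntegral_of_mem_reesAdjoin (monomial_mem_reesAdjoin i)

theorem isIntegral_of_mem_gradedRing
    (hfil : ∀ d : ℕ, δ.filtration d = integralFiltration K e y d) {x : Polynomial A}
    (hx : x ∈ δ.gradedRing) : IsIntegral (reesAdjoin K e y) x := by
  rw [x.as_sum_support]
  refine IsIntegral.sum _ fun i _ => ?_
  have h := hx i
  rw [hfil] at h
  exact h

/-- Being radical can be checked on homogeneous elements, where it says that degrees may be
compared after taking powers. -/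
theorem isRadical_span_t [IsDomain A]
    (h : ∀ (k j d : ℕ) (f : A), 0 < k → j < k * (d + 1) → f ^ k ∈ δ.filtration j →
      f ∈ δ.filtration d) : (Ideal.span {δ.t}).IsRadical := by
  have hI : (Ideal.span {δ.t}).IsHomogeneous δ.grading := by
    refine Ideal.homogeneous_span _ _ ?_
    rintro _ rfl
    exact ⟨1, δ.t_mem_grading⟩
  intro x hx
  rw [hI.mem_iff]
  intro d
  have hd := hI.radical d hx
  have hdm := (DirectSum.decompose δ.grading x d).2
  generalize (DirectSum.decompose δ.grading x d : δ.gradedRing) = w at hd hdm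
  rw [δ.eq_homog_of_mem_grading hdm] at hd ⊢
  generalize (w : Polynomial A).coeff d = f, w.2 d = hf at hd ⊢
  obtain ⟨k, hk⟩ := hd
  have hk' : δ.homog d f hf ^ (k + 1) ∈ Ideal.span {δ.t} := by
    rw [pow_succ]
    exact Ideal.mul_mem_right _ _ hk
  obtain ⟨g, hg⟩ := Ideal.mem_span_singleton'.1 hk'
  have h1 : (g : Polynomial A) * Polynomial.X = Polynomial.monomial d f ^ (k + 1) :=
    congrArg (fun p : δ.gradedRing => (p : Polynomial A)) hg
  rw [Polynomial.monomial_pow] at h1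
  rcases d with _ | d
  · have h2 := congrArg (fun p : Polynomial A => p.coeff 0) h1
    simp only [Polynomial.mul_coeff_zero, Polynomial.coeff_X_zero, mul_zero, zero_mul,
      Polynomial.coeff_monomial_same] at h2
    obtain rfl : f = 0 := pow_eq_zero_iff (Nat.succ_ne_zero k) |>.1 h2.symm
    rw [homog_zero]
    exact zero_mem _
  · have h2 := congrArg (fun p : Polynomial A => p.coeff ((d + 1) * k + d + 1)) h1
    simp only [Polynomial.coeff_mul_X] at h2
    rw [Polynomial.coeff_monomial, if_pos (by ring)] at h2
    have h3 := g.2 ((d + 1) * k + d)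
    rw [h2] at h3
    have h4 : f ∈ δ.filtration d := h (k + 1) _ d f (Nat.succ_pos k) (by lia) h3
    rw [δ.homog_add_right h4 1, pow_one]
    exact Ideal.mul_mem_right _ _ (Ideal.mem_span_singleton_self _)

/-- A homomorphism to a domain that kills `t` and the `(yᵢ)_e` is scalar: the graded ring is
integral over the algebra they generate, and `K` is algebraically closed. -/
theorem exists_algebraMap_eq_of_map_eq_zero [IsAlgClosed K] {Q : Type*} [CommRing Q] [IsDomain Q]
    [Algebra K Q] (hfil : ∀ d : ℕ, δ.filtration d = integralFiltration K e y d)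
    (π : δ.gradedRing →ₐ[K] Q) (ht : π δ.t = 0)
    (hy : ∀ i, ∃ h : y i ∈ δ.filtration e, π (δ.homog e (y i) h) = 0) (x : δ.gradedRing) :
    ∃ c : K, π x = algebraMap K Q c := by
  refine exists_algebraMap_eq_of_isIntegral (le_gradedRing_of_filtration_eq hfil) π
    (fun a => ?_) x (isIntegral_of_mem_gradedRing hfil x.2)
  have hle : reesAdjoin K e y ≤ ((⊥ : Subalgebra K Q).comap π).map δ.gradedRing.val := by
    refine reesAdjoin_le_of_mem _ ⟨δ.t, ?_, rfl⟩ fun i => ?_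
    · change π δ.t ∈ (⊥ : Subalgebra K Q)
      rw [ht]
      exact zero_mem _
    · obtain ⟨h1, h2⟩ := hy i
      refine ⟨δ.homog e (y i) h1, ?_, rfl⟩
      change π (δ.homog e (y i) h1) ∈ (⊥ : Subalgebra K Q)
      rw [h2]
      exact zero_mem _
  obtain ⟨b, hb, hba⟩ := hle a.2
  obtain rfl : b = Subalgebra.inclusion (le_gradedRing_of_filtration_eq hfil) a :=
    Subtype.ext hba
  exact hb

theorem irrelevant_le_of_mem_vanishingPart [IsAlgClosed K]
    (hfil : ∀ d : ℕ, δ.filtration d = integralFiltration K e y d)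
    (P : HomogeneousIdeal δ.grading) (hP : P.toIdeal.IsPrime) (ht : δ.t ∈ P)
    (hy : ∀ i, y i ∈ δ.vanishingPart P.toIdeal e) :
    HomogeneousIdeal.irrelevant δ.grading ≤ P := by
  have hx : ∀ x : δ.gradedRing, ∃ c : K, x - algebraMap K δ.gradedRing c ∈ P.toIdeal := by
    intro x
    have h0 := exists_algebraMap_eq_of_map_eq_zero (Q := δ.gradedRing ⧸ P.toIdeal) hfil
      (Ideal.Quotient.mkₐ K P.toIdeal) (Ideal.Quotient.eq_zero_iff_mem.2 ht)
      (fun i => (hy i).imp fun _ h => Ideal.Quotient.eq_zero_iff_mem.2 h) x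
    obtain ⟨c, hc⟩ := h0
    exact ⟨c, Ideal.Quotient.eq.1 hc⟩
  rw [HomogeneousIdeal.irrelevant_le]
  intro d hd x hxd
  obtain ⟨c, hc⟩ := hx x
  exact P.mem_of_sub_algebraMap_mem (c := c) hd hxd hc

end

end DegreeLike

section Existence

variable {K A : Type*} [Field K] [CommRing A] [IsDomain A] [Algebra K A] {n : ℕ} {y : Fin n → A}

omit [IsDomain A] in
theorem exists_bound_natDegree [Algebra.FiniteType K A]
    (h : ∀ f, ∃ d, f ∈ integralFiltration K 1 y d) :
    ∃ M : ℕ, ∀ f : A, ∃ G : Polynomial (MvPolynomial (Fin n) K), G.Monic ∧ G.natDegree ≤ M ∧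
      G.eval₂ (MvPolynomial.aeval y : MvPolynomial (Fin n) K →ₐ[K] A).toRingHom f = 0 := by
  let := (MvPolynomial.aeval y : MvPolynomial (Fin n) K →ₐ[K] A).toRingHom.toAlgebra
  have : IsScalarTower K (MvPolynomial (Fin n) K) A := IsScalarTower.of_algebraMap_eq fun c =>
    ((MvPolynomial.aeval y : MvPolynomial (Fin n) K →ₐ[K] A).commutes c).symm
  have hint : Algebra.IsIntegral (MvPolynomial (Fin n) K) A := ⟨fun f => by
    obtain ⟨d, hd⟩ := h f
    obtain ⟨G, hG, hGf, -⟩ := exists_monic_hasSlopeLE hd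
    exact ⟨G, hG, hGf⟩⟩
  have : Algebra.FiniteType (MvPolynomial (Fin n) K) A :=
    Algebra.FiniteType.of_restrictScalars_finiteType K _ _
  have : Module.Finite (MvPolynomial (Fin n) K) A := Algebra.IsIntegral.finite
  exact ⟨_, fun f => ⟨minpoly (MvPolynomial (Fin n) K) f, minpoly.monic (hint.isIntegral f),
    minpoly.natDegree_le_spanFinrank _ f, minpoly.aeval _ f⟩⟩

/-- Any finite set of generators can be given a common degree by a complete quasidegree, in such a
way that no point at infinity lies on all the hypersurfaces they define there. -/
theorem exists_isComplete_isQuasidegree [IsAlgClosed K] [Algebra.FiniteType K A] {N : ℕ}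
    (z : Fin N → A) (hz : Algebra.adjoin K (Set.range z) = ⊤) :
    ∃ (δ : DegreeLike K A) (e : ℕ), 0 < e ∧ δ.IsComplete ∧ δ.IsQuasidegree ∧
      (∀ j, z j ∈ δ.filtration e) ∧
      ∀ P : HomogeneousIdeal δ.grading, P.toIdeal.IsPrime → δ.t ∈ P →
        (∀ j, z j ∈ δ.vanishingPart P.toIdeal e) → HomogeneousIdeal.irrelevant δ.grading ≤ P := by
  obtain ⟨n, y, hy, hyz, hzint⟩ := exists_algebraicIndependent_isIntegral_reesAdjoin (K := K) N z
  have hex : ∀ e f, ∃ d, f ∈ integralFiltration K e y d := fun e =>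
    exists_mem_integralFiltration hz hzint
  obtain ⟨M, hM⟩ := exists_bound_natDegree (hex 1)
  let δ : DegreeLike K A := DegreeLike.ofFiltration (integralFiltration K M.factorial y)
    (hex _) integralFiltration_mono one_mem_integralFiltration mul_mem_integralFiltration
  have hfil : ∀ d : ℕ, δ.filtration d = integralFiltration K M.factorial y d := fun d =>
    DegreeLike.filtration_ofFiltration _ _ _ _ d
  have hneg : ∀ d : ℤ, d < 0 → δ.filtration d = ⊥ := fun d hd =>
    DegreeLike.filtration_ofFiltration_of_neg _ _ _ _ hd
  have hFT : Algebra.FiniteType K δ.gradedRing := finiteType_of_isIntegral_reesAdjoin hy (hex _) _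
    (DegreeLike.le_gradedRing_of_filtration_eq hfil)
    fun x hx => DegreeLike.isIntegral_of_mem_gradedRing hfil hx
  have : IsNoetherianRing δ.gradedRing := Algebra.FiniteType.isNoetherianRing K _
  have hze : ∀ j, z j ∈ δ.filtration M.factorial := fun j => by
    have h1 : z j ∈ integralFiltration K 1 y 1 := hzint j
    have h2 := isIntegral_expand M.factorial h1
    rw [one_mul] at h2
    rw [hfil]
    exact h2
  refine ⟨δ, M.factorial, M.factorial_pos, ⟨hneg, hFT, ?_⟩, ?_, hze, ?_⟩
  · apply le_antisymm
    · intro f hf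
      have h1 : f ∈ integralFiltration K M.factorial y 0 := hfil 0 ▸ hf
      exact mem_range_algebraMap_of_mem_integralFiltration_zero M.factorial_pos h1
    · rintro _ ⟨c, rfl⟩
      exact δ.const_le' c
  · refine DegreeLike.isQuasidegree_of_isRadical _ hneg (DegreeLike.isRadical_span_t ?_)
    intro k j d f hk hj hf
    rw [hfil] at hf ⊢
    exact mem_integralFiltration_of_pow_mem_of_lt hy hM hk hj hf
  · intro P hP ht hzP
    refine DegreeLike.irrelevant_le_of_mem_vanishingPart hfil P hP ht fun i => ?_
    refine (Submodule.span_le (p := δ.vanishingPart P.toIdeal M.factorial)).2 ?_ (hyz i)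
    rintro _ ⟨j, rfl⟩
    exact hzP j

end Existence

/-! ### Dimension and transcendence degree -/

/-- Going up and incomparability. -/
theorem ringKrullDim_eq_of_isIntegral {R S : Type*} [CommRing R] [CommRing S] [Algebra R S]
    [FaithfulSMul R S] [Algebra.IsIntegral R S] : ringKrullDim R = ringKrullDim S := by
  apply le_antisymm
  · refine iSup_le fun l => ?_
    obtain ⟨Q, hQ⟩ := Algebra.IsIntegral.comap_surjective R S l.head
    have : Q.asIdeal.LiesOver l.head.asIdeal := ⟨by rw [← hQ]; rfl⟩
    obtain ⟨L, hL, -⟩ := Ideal.exists_ltSeries_of_hasGoingUp l Q.asIdeal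
    rw [← hL]
    exact Order.LTSeries.length_le_krullDim L
  · exact Order.krullDim_le_of_strictMono (PrimeSpectrum.comap (algebraMap R S))
      fun _ _ h => Ideal.IsIntegral.comap_lt_comap h

theorem exists_ringKrullDim_eq_trdeg_eq (K A : Type*) [Field K] [CommRing A] [IsDomain A]
    [Algebra K A] [Algebra.FiniteType K A] :
    ∃ n : ℕ, ringKrullDim A = n ∧ Algebra.trdeg K A = n := by
  obtain ⟨n, g, hg, hint⟩ := exists_integral_inj_algHom_of_fg K A
  let := g.toRingHom.toAlgebra
  have : IsScalarTower K (MvPolynomial (Fin n) K) A :=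
    IsScalarTower.of_algebraMap_eq fun c => (g.commutes c).symm
  have : FaithfulSMul (MvPolynomial (Fin n) K) A := (faithfulSMul_iff_algebraMap_injective _ _).2 hg
  have : Algebra.IsIntegral (MvPolynomial (Fin n) K) A := ⟨hint⟩
  refine ⟨n, ?_, ?_⟩
  · rw [← ringKrullDim_eq_of_isIntegral (R := MvPolynomial (Fin n) K),
      MvPolynomial.ringKrullDim_of_isNoetherianRing, ringKrullDim_eq_zero_of_field, zero_add,
      Nat.card_fin]
  · have h := lift_trdeg_add_eq K (MvPolynomial (Fin n) K) A
    rw [trdeg_eq_zero (R := MvPolynomial (Fin n) K)] at h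
    simpa using h.symm

theorem isAlgebraic_of_ringKrullDim_eq (K : Type*) {A B : Type*} [Field K] [CommRing A]
    [IsDomain A] [Algebra K A] [Algebra.FiniteType K A] [CommRing B] [IsDomain B] [Algebra K B]
    [Algebra.FiniteType K B] [Algebra B A] [IsScalarTower K B A] [FaithfulSMul B A]
    (h : ringKrullDim A = ringKrullDim B) : Algebra.IsAlgebraic B A := by
  obtain ⟨n, hn, hn'⟩ := exists_ringKrullDim_eq_trdeg_eq K A
  obtain ⟨m, hm, hm'⟩ := exists_ringKrullDim_eq_trdeg_eq K B
  obtain rfl : n = m := by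
    rw [hn, hm] at h
    exact_mod_cast h
  have h1 := lift_trdeg_add_eq K B A
  rw [hn', hm', Cardinal.lift_natCast, Cardinal.lift_natCast] at h1
  have h2 : (n : Cardinal) + _ = (n : Cardinal) + 0 := h1.trans (add_zero _).symm
  have h3 := Cardinal.eq_of_add_eq_add_left h2 (Cardinal.natCast_lt_aleph0)
  rw [Cardinal.lift_eq_zero] at h3
  exact trdeg_eq_zero_iff.1 h3

/-! ### Hilbert's Nullstellensatz -/

theorem exists_monic_aeval_mem_of_finite_zeroLocus {K A : Type*} [Field K] [CommRing A]
    [Algebra K A] [Algebra.FiniteType K A] {J : Ideal A}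
    (hJ : (PrimeSpectrum.zeroLocus (J : Set A)).Finite) (x : A) :
    ∃ p : Polynomial K, p.Monic ∧ Polynomial.aeval x p ∈ J := by
  have hfin : Finite (PrimeSpectrum (A ⧸ J)) := by
    have hinj : Function.Injective (PrimeSpectrum.comap (Ideal.Quotient.mk J)) :=
      PrimeSpectrum.comap_injective_of_surjective _ Ideal.Quotient.mk_surjective
    rw [← Set.finite_univ_iff, ← Set.finite_image_iff hinj.injOn, Set.image_univ,
      range_comap_of_surjective _ _ Ideal.Quotient.mk_surjective, Ideal.mk_ker]
    exact hJ
  have hjac : IsJacobsonRing (A ⧸ J) := isJacobsonRing_of_finiteType (A := K)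
  have hdim : Ring.KrullDimLE 0 (A ⧸ J) :=
    (PrimeSpectrum.discreteTopology_iff_finite_and_krullDimLE_zero.1 inferInstance).2
  have : Module.Finite K (A ⧸ J) := (Module.finite_iff_krullDimLE_zero K (A ⧸ J)).2 hdim
  obtain ⟨p, hp, hpx⟩ := Algebra.IsIntegral.isIntegral (R := K) (Ideal.Quotient.mkₐ K J x)
  refine ⟨p, hp, Ideal.Quotient.eq_zero_iff_mem.1 ?_⟩
  change Ideal.Quotient.mkₐ K J (Polynomial.aeval x p) = 0
  rw [← Polynomial.aeval_algHom_apply]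
  exact hpx

/-- A nonzero function on a variety over an algebraically closed field is nonzero at some rational
point. -/
theorem exists_algHom_apply_ne_zero {K A : Type*} [Field K] [IsAlgClosed K] [CommRing A]
    [IsDomain A] [Algebra K A] [Algebra.FiniteType K A] {h : A} (hh : h ≠ 0) :
    ∃ x : A →ₐ[K] K, x h ≠ 0 := by
  have hjac : IsJacobsonRing A := isJacobsonRing_of_finiteType (A := K)
  have h1 : h ∉ (⊥ : Ideal A).jacobson := by
    rw [← Ideal.radical_eq_jacobson, Ideal.IsPrime.radical Ideal.isPrime_bot]
    exact hh
  rw [Ideal.jacobson, Submodule.mem_sInf] at h1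
  push Not at h1
  obtain ⟨m, ⟨-, hm⟩, hhm⟩ := h1
  let := Ideal.Quotient.field m
  have : Module.Finite K (A ⧸ m) := finite_of_finite_type_of_isJacobsonRing K (A ⧸ m)
  have hbij : Function.Bijective (algebraMap K (A ⧸ m)) :=
    IsAlgClosed.algebraMap_bijective_of_isIntegral
  let E : K ≃ₐ[K] A ⧸ m := AlgEquiv.ofBijective (Algebra.ofId K (A ⧸ m)) hbij
  refine ⟨(E.symm : (A ⧸ m) →ₐ[K] K).comp (Ideal.Quotient.mkₐ K m), fun h2 => hhm ?_⟩
  exact Ideal.Quotient.eq_zero_iff_mem.1 ((map_eq_zero_iff E.symm E.symm.injective).1 h2)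

/-! ### A criterion for preserving intersections at infinity -/

section Criterion

variable {K A : Type*} [Field K] [CommRing A] [Algebra K A]

/-- The identity `(x^l)^k = (x^k)^l * 1^(k-l)` in equal degrees, with `(1)_e = t^e` vanishing at
infinity. -/
theorem DegreeLike.pow_mem_vanishingPart {δ : DegreeLike K A} {P : Ideal δ.gradedRing}
    [P.IsPrime] (ht : δ.t ∈ P) {e : ℕ} (he : 0 < e) {x : A} {k l : ℕ} (hlk : l < k)
    (hl : x ^ l ∈ δ.filtration e) (hk : x ^ k ∈ δ.filtration e) :
    x ^ l ∈ δ.vanishingPart P e := by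
  refine ⟨hl, ‹P.IsPrime›.mem_of_pow_mem k ?_⟩
  obtain ⟨m, rfl⟩ := Nat.exists_eq_add_of_lt hlk
  have h : δ.homog e (x ^ l) hl ^ (l + m + 1) =
      δ.homog e (x ^ (l + m + 1)) hk ^ l * δ.t ^ (e * (m + 1)) := by
    refine Subtype.ext ?_
    change Polynomial.monomial e (x ^ l) ^ (l + m + 1) =
      Polynomial.monomial e (x ^ (l + m + 1)) ^ l * Polynomial.monomial 1 1 ^ (e * (m + 1))
    rw [Polynomial.monomial_pow, Polynomial.monomial_pow, Polynomial.monomial_pow,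
      Polynomial.monomial_mul_monomial, one_pow, mul_one, ← pow_mul, ← pow_mul]
    congr 1
    · congr 1
      ring
    · congr 1
      ring
  rw [h]
  exact P.mul_mem_left _ (Ideal.pow_mem_of_mem _ ht _ (Nat.mul_pos he (Nat.succ_pos m)))

theorem pow_mem_of_sum_mem {V : Submodule K A} {x : A} {b : ℕ → K} {k : ℕ} (hb : b k ≠ 0)
    (hlt : ∀ l < k, x ^ l ∈ V) (hsum : ∑ l ∈ Finset.range (k + 1), b l • x ^ l ∈ V) {l : ℕ}
    (hl : l ≤ k) : x ^ l ∈ V := by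
  rcases hl.lt_or_eq with h | rfl
  · exact hlt l h
  · rw [Finset.sum_range_succ] at hsum
    have h1 : ∑ i ∈ Finset.range l, b i • x ^ i ∈ V :=
      sum_mem fun i hi => V.smul_mem _ (hlt i (Finset.mem_range.1 hi))
    exact (V.smul_mem_iff hb).1 ((V.add_mem_iff_right h1).1 hsum)

end Criterion

/-- A finite-dimensional generating space `W` gives a complete quasidegree for which preserving an
intersection at infinity is a question of linear algebra: at a common point at infinity, the
elements of `W` whose leading forms vanish are a subspace `V` of `W`, and it suffices that the
known elements of `V` force `V = W`. -/
theorem exists_completion_preservesIntersectionAtInfinity {K : Type w} {A : Type u} [Field K]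
    [IsAlgClosed K] [CommRing A] [IsDomain A] [Algebra K A] [Algebra.FiniteType K A]
    {W : Submodule K A} (hfg : W.FG) (hW : Algebra.adjoin K (W : Set A) = ⊤) :
    ∃ δ : DegreeLike K A, δ.IsComplete ∧ δ.IsQuasidegree ∧
      ∀ (r : ℕ) (I : Fin r → Ideal A),
        (∀ V : Submodule K A, (∀ i, ∀ w ∈ W, w ∈ I i → w ∈ V) →
          (∀ x : A, ∀ k l, l < k → x ^ l ∈ W → x ^ k ∈ W → x ^ l ∈ V) → W ≤ V) →
        PreservesIntersectionAtInfinity δ.completion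
          (fun i => (PrimeSpectrum.zeroLocus (I i : Set A) : Set (Spec (CommRingCat.of A)))) := by
  obtain ⟨N, z, rfl⟩ := Submodule.fg_iff_exists_fin_generating_family.1 hfg
  rw [Algebra.adjoin_span] at hW
  obtain ⟨δ, e, he, hc, hq, hz, hirr⟩ := exists_isComplete_isQuasidegree z hW
  refine ⟨δ, hc, hq, fun r I hI => ?_⟩
  have hWe : Submodule.span K (Set.range z) ≤ δ.filtration e :=
    Submodule.span_le.2 (Set.range_subset_iff.2 hz)
  refine δ.preservesIntersectionAtInfinity_of_irrelevant_le I fun P hP ht hPI => ?_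
  refine hirr P hP ht fun j => ?_
  refine hI (δ.vanishingPart P.toIdeal e) ?_ ?_ (Submodule.subset_span ⟨j, rfl⟩)
  · exact fun i w hw hwi => ⟨hWe hw, hPI i e w he hwi (hWe hw)⟩
  · exact fun x k l hlk hl hk => DegreeLike.pow_mem_vanishingPart ht he hlk (hWe hl) (hWe hk)

/-! ### Finite intersections -/

section Intersections

variable {K : Type w} {A : Type u} [Field K] [IsAlgClosed K] [CommRing A] [IsDomain A]
  [Algebra K A] [Algebra.FiniteType K A]

/-- The generating space consists of the powers `x^l`, `l ≤ deg p`, of generators `x` and the terms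
`fᵢ ∈ Iᵢ` of relations `p(x) = ∑ᵢ fᵢ` with `p` monic. -/
theorem exists_completion_of_finite_iInter {m : ℕ} (V : Fin m → Set (Spec (CommRingCat.of A)))
    (hV : ∀ i, IsClosed (V i)) (hfin : (⋂ i, V i).Finite) :
    ∃ δ : DegreeLike K A, δ.IsComplete ∧ δ.IsQuasidegree ∧
      PreservesIntersectionAtInfinity δ.completion V := by
  classical
  have hI : ∀ i, ∃ I : Ideal A, V i = PrimeSpectrum.zeroLocus (I : Set A) := fun i =>
    (PrimeSpectrum.isClosed_iff_zeroLocus_ideal _).1 (hV i)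
  choose I hI using hI
  obtain rfl : V = fun i => PrimeSpectrum.zeroLocus (I i : Set A) := funext hI
  have hJ : (PrimeSpectrum.zeroLocus ((⨆ i, I i : Ideal A) : Set A)).Finite := by
    rw [PrimeSpectrum.zeroLocus_iSup]
    exact hfin
  -- the factor `X` makes the degrees positive, so that `x` itself is among the powers below
  have hp : ∀ x : A, ∃ p : Polynomial K, p.Monic ∧ 1 ≤ p.natDegree ∧
      ∃ f : Fin m → A, (∀ i, f i ∈ I i) ∧ ∑ i, f i = Polynomial.aeval x p := by
    intro x
    obtain ⟨p, hp, hpx⟩ := exists_monic_aeval_mem_of_finite_zeroLocus (K := K) hJ x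
    have h1 : Polynomial.aeval x (p * Polynomial.X) ∈ ⨆ i ∈ Finset.univ, I i := by
      rw [map_mul]
      simpa using Ideal.mul_mem_right _ _ hpx
    obtain ⟨f, hf⟩ := (Submodule.mem_iSup_finset_iff_exists_sum _ _).1 h1
    refine ⟨p * Polynomial.X, hp.mul Polynomial.monic_X, ?_, fun i => f i, fun i => (f i).2, hf⟩
    rw [hp.natDegree_mul Polynomial.monic_X, Polynomial.natDegree_X]
    exact Nat.le_add_left 1 _
  choose p hp hdeg f hf hsum using hp
  obtain ⟨s, hs⟩ := Algebra.FiniteType.out (R := K) (A := A)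
  let powers : Set A := ⋃ x ∈ s, (fun l => x ^ l) '' Set.Iic (p x).natDegree
  let rests : Set A := ⋃ x ∈ s, Set.range (f x)
  let W : Submodule K A := Submodule.span K (powers ∪ rests)
  have hpow : ∀ x ∈ s, ∀ l ≤ (p x).natDegree, x ^ l ∈ W := fun x hx l hl =>
    Submodule.subset_span (Or.inl (Set.mem_biUnion hx ⟨l, hl, rfl⟩))
  have hrest : ∀ x ∈ s, ∀ i, f x i ∈ W := fun x hx i =>
    Submodule.subset_span (Or.inr (Set.mem_biUnion hx ⟨i, rfl⟩))
  have hfg : W.FG := by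
    refine Submodule.fg_span (Set.Finite.union ?_ ?_)
    · exact s.finite_toSet.biUnion fun x _ => (Set.finite_Iic _).image _
    · exact s.finite_toSet.biUnion fun x _ => Set.finite_range _
  have hW : Algebra.adjoin K (W : Set A) = ⊤ := by
    rw [eq_top_iff, ← hs]
    refine Algebra.adjoin_mono fun x hx => ?_
    simpa using hpow x hx 1 (hdeg x)
  obtain ⟨δ, hc, hq, hδ⟩ := exists_completion_preservesIntersectionAtInfinity hfg hW
  refine ⟨δ, hc, hq, hδ m I fun U hUI hUpow => ?_⟩
  have hrestU : ∀ x ∈ s, ∀ i, f x i ∈ U := fun x hx i =>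
    hUI i _ (hrest x hx i) (hf x i)
  refine Submodule.span_le.2 (Set.union_subset ?_ ?_)
  · refine Set.iUnion₂_subset fun x hx => ?_
    rintro _ ⟨l, hl, rfl⟩
    refine pow_mem_of_sum_mem (b := (p x).coeff) (k := (p x).natDegree) ?_
      (fun l hl => hUpow x _ l hl (hpow x hx l hl.le) (hpow x hx _ le_rfl)) ?_ hl
    · rw [(hp x).coeff_natDegree]
      exact one_ne_zero
    · rw [← Polynomial.aeval_eq_sum_range, ← hsum x]
      exact sum_mem fun i _ => hrestU x hx i
  · refine Set.iUnion₂_subset fun x hx => ?_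
    rintro _ ⟨i, rfl⟩
    exact hrestU x hx i

end Intersections

/-! ### Generically finite morphisms -/

section Morphisms

variable {K A : Type*} [Field K] [CommRing A] [Algebra K A] {r : ℕ}

/-- The span of `1` and the functions `f`; its `n`-th power consists of the polynomials of degree
at most `n` in the `f i`. -/
def degreeLEOne (K : Type*) {A : Type*} [Field K] [CommRing A] [Algebra K A] {r : ℕ}
    (f : Fin r → A) : Submodule K A :=
  Submodule.span K (insert 1 (Set.range f))

variable {f : Fin r → A}

theorem one_le_degreeLEOne : 1 ≤ degreeLEOne K f :=
  Submodule.one_le.2 (Submodule.subset_span (Set.mem_insert _ _))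

theorem apply_mem_degreeLEOne (i : Fin r) : f i ∈ degreeLEOne K f :=
  Submodule.subset_span (Set.mem_insert_of_mem _ ⟨i, rfl⟩)

theorem degreeLEOne_pow_mono {n k : ℕ} (h : n ≤ k) : degreeLEOne K f ^ n ≤ degreeLEOne K f ^ k :=
  pow_le_pow_right₀ one_le_degreeLEOne h

theorem exists_mem_degreeLEOne_pow {g : A} (hg : g ∈ Algebra.adjoin K (Set.range f)) :
    ∃ n, g ∈ degreeLEOne K f ^ n := by
  induction hg using Algebra.adjoin_induction with
  | mem x hx =>
    obtain ⟨i, rfl⟩ := hx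
    exact ⟨1, by rw [pow_one]; exact apply_mem_degreeLEOne i⟩
  | algebraMap c => exact ⟨0, by rw [pow_zero]; exact Submodule.algebraMap_mem c⟩
  | add x y _ _ hx hy =>
    obtain ⟨a, ha⟩ := hx
    obtain ⟨b, hb⟩ := hy
    exact ⟨max a b, add_mem (degreeLEOne_pow_mono (le_max_left a b) ha)
      (degreeLEOne_pow_mono (le_max_right a b) hb)⟩
  | mul x y _ _ hx hy =>
    obtain ⟨a, ha⟩ := hx
    obtain ⟨b, hb⟩ := hy
    exact ⟨a + b, by rw [pow_add]; exact Submodule.mul_mem_mul ha hb⟩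

/-- A polynomial expression `g` in the functions `f` may be replaced by its value, step by step:
it differs from it by a combination of the `fᵢ - fᵢ(x)`. -/
theorem sub_algebraMap_mul_mem (x : A →ₐ[K] K) {V : Submodule K A} {u : A} {D : ℕ}
    (hV : ∀ i, ∀ n < D, ∀ h ∈ degreeLEOne K f ^ n, (f i - algebraMap K A (x (f i))) * h * u ∈ V)
    {n : ℕ} (hn : n ≤ D) {g : A} (hg : g ∈ degreeLEOne K f ^ n) :
    (g - algebraMap K A (x g)) * u ∈ V := by
  induction n generalizing g with
  | zero =>
    rw [pow_zero] at hg
    obtain ⟨c, rfl⟩ := Submodule.mem_one.1 hg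
    rw [AlgHom.commutes, Algebra.algebraMap_self_apply, sub_self, zero_mul]
    exact zero_mem V
  | succ n ih =>
    rw [pow_succ'] at hg
    induction hg using Submodule.mul_induction_on' with
    | add a _ b _ ha hb =>
      rw [map_add, map_add]
      convert add_mem ha hb using 1
      ring
    | mem_mul_mem a ha h hh =>
      have h1 : (a - algebraMap K A (x a)) * h * u ∈ V := by
        unfold degreeLEOne at ha
        induction ha using Submodule.span_induction with
        | mem a ha =>
          obtain rfl | ⟨i, rfl⟩ := ha
          · rw [map_one, map_one, sub_self, zero_mul, zero_mul]
            exact zero_mem V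
          · exact hV i n hn h hh
        | zero =>
          rw [map_zero, map_zero, sub_self, zero_mul, zero_mul]
          exact zero_mem V
        | add a b _ _ ha hb =>
          rw [map_add, map_add]
          convert add_mem ha hb using 1
          ring
        | smul c a _ ha =>
          convert V.smul_mem c ha using 1
          rw [map_smul, smul_eq_mul, map_mul, Algebra.smul_def, Algebra.smul_def]
          ring
      have h2 := V.smul_mem (x a) (ih (Nat.le_of_succ_le hn) hh)
      convert add_mem h1 h2 using 1
      rw [map_mul, map_mul, Algebra.smul_def]
      ring

/-- At a point at infinity of the fibre through `x`, where the leading coefficient of an equation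
of `z` over `K[f]` does not vanish at `x`, the leading forms of all `g z^l` vanish. -/
theorem mul_pow_mem_of_sum_eq_zero (x : A →ₐ[K] K) {V : Submodule K A} {z : A} {D k : ℕ}
    (hV : ∀ i, ∀ n < D, ∀ h ∈ degreeLEOne K f ^ n, ∀ l ≤ k,
      (f i - algebraMap K A (x (f i))) * h * z ^ l ∈ V)
    (hlt : ∀ l < k, z ^ l ∈ V) {b : ℕ → A} (hb : ∀ l ≤ k, b l ∈ degreeLEOne K f ^ D)
    (hsum : ∑ l ∈ Finset.range (k + 1), b l * z ^ l = 0) (hk : x (b k) ≠ 0) {l : ℕ}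
    (hl : l ≤ k) {g : A} (hg : g ∈ degreeLEOne K f ^ D) : g * z ^ l ∈ V := by
  have hsub : ∀ l ≤ k, ∀ g ∈ degreeLEOne K f ^ D, (g - algebraMap K A (x g)) * z ^ l ∈ V :=
    fun l hl g hg => sub_algebraMap_mul_mem x (fun i n hn h hh => hV i n hn h hh l hl) le_rfl hg
  have hpow : z ^ l ∈ V := by
    refine pow_mem_of_sum_mem (b := fun l => x (b l)) hk hlt ?_ hl
    have h1 : ∑ l ∈ Finset.range (k + 1), x (b l) • z ^ l =
        -∑ l ∈ Finset.range (k + 1), (b l - algebraMap K A (x (b l))) * z ^ l := by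
      simp only [sub_mul, Finset.sum_sub_distrib, hsum, Algebra.smul_def]
      ring
    rw [h1]
    exact neg_mem (sum_mem fun l hl => hsub l (Nat.lt_succ_iff.1 (Finset.mem_range.1 hl)) _
      (hb l (Nat.lt_succ_iff.1 (Finset.mem_range.1 hl))))
  have h2 := add_mem (hsub l hl g hg) (V.smul_mem (x g) hpow)
  convert h2 using 1
  rw [Algebra.smul_def]
  ring

end Morphisms

section MapAtInfinity

variable {K : Type w} {A : Type u} {B : Type v} [Field K] [IsAlgClosed K] [CommRing A] [IsDomain A]
  [Algebra K A] [Algebra.FiniteType K A] [CommRing B] [IsDomain B] [Algebra K B]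

/-- The generating space consists of the products of powers `z^l`, `l ≤ deg p`, of generators `z`
with equations `p` over `B`, and polynomials of bounded degree in the functions `φ (y i)`. -/
theorem exists_completion_preservesMapAtInfinity {r : ℕ} (y : Fin r → B) (φ : B →ₐ[K] A)
    (hy : Algebra.adjoin K (Set.range y) = ⊤)
    (hφ : DenseRange (PrimeSpectrum.comap φ.toRingHom))
    (hdim : ringKrullDim A = ringKrullDim B) :
    ∃ δ : DegreeLike K A, δ.IsComplete ∧ δ.IsQuasidegree ∧
      PreservesMapAtInfinity K δ.completion (fun i => φ (y i)) := by
  classical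
  have hinj : Function.Injective φ := by
    rw [injective_iff_map_eq_zero]
    intro b hb
    have h1 := (PrimeSpectrum.denseRange_comap_iff_ker_le_nilRadical _).1 hφ hb
    rwa [nilradical_eq_zero] at h1
  have : Algebra.FiniteType K B :=
    ⟨⟨(Set.finite_range y).toFinset, by rw [Set.Finite.coe_toFinset, hy]⟩⟩
  let := φ.toRingHom.toAlgebra
  have : IsScalarTower K B A := IsScalarTower.of_algebraMap_eq fun c => (φ.commutes c).symm
  have : FaithfulSMul B A := (faithfulSMul_iff_algebraMap_injective _ _).2 hinj
  have halg : Algebra.IsAlgebraic B A := isAlgebraic_of_ringKrullDim_eq K hdim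
  -- the factor `X` makes the degrees positive, so that `z` itself is among the powers below
  have hp : ∀ z : A, ∃ p : Polynomial B, p ≠ 0 ∧ 1 ≤ p.natDegree ∧ Polynomial.aeval z p = 0 := by
    intro z
    obtain ⟨p, hp, hpz⟩ := halg.isAlgebraic z
    refine ⟨p * Polynomial.X, mul_ne_zero hp Polynomial.X_ne_zero, ?_, ?_⟩
    · rw [Polynomial.natDegree_mul_X hp]
      exact Nat.le_add_left 1 _
    · rw [map_mul, hpz, zero_mul]
  choose p hp hdeg hpz using hp
  have hcoeff : ∀ b : B, ∃ n, φ b ∈ degreeLEOne K (fun i => φ (y i)) ^ n := by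
    intro b
    refine exists_mem_degreeLEOne_pow ?_
    have h1 : φ b ∈ (Algebra.adjoin K (Set.range y)).map φ :=
      ⟨b, by rw [hy]; exact Algebra.mem_top, rfl⟩
    rwa [AlgHom.map_adjoin, ← Set.range_comp] at h1
  choose ν hν using hcoeff
  obtain ⟨s, hs⟩ := Algebra.FiniteType.out (R := K) (A := A)
  set M := degreeLEOne K (fun i => φ (y i)) with hM
  let D := s.sup fun z => (Finset.range ((p z).natDegree + 1)).sup fun l => ν ((p z).coeff l)
  have hD : ∀ z ∈ s, ∀ l ≤ (p z).natDegree, φ ((p z).coeff l) ∈ M ^ D := by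
    intro z hz l hl
    refine degreeLEOne_pow_mono ?_ (hν _)
    refine le_trans ?_ (Finset.le_sup (f := fun z =>
      (Finset.range ((p z).natDegree + 1)).sup fun l => ν ((p z).coeff l)) hz)
    exact Finset.le_sup (f := fun l => ν ((p z).coeff l))
      (Finset.mem_range.2 (Nat.lt_succ_of_le hl))
  let L : A → Submodule K A := fun z =>
    Submodule.span K ((fun l => z ^ l) '' Set.Iic (p z).natDegree)
  let W : Submodule K A := ⨆ z ∈ s, M ^ D * L z
  have hLW : ∀ z ∈ s, ∀ l ≤ (p z).natDegree, ∀ g ∈ M ^ D, g * z ^ l ∈ W := fun z hz l hl g hg =>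
    Submodule.mem_iSup_of_mem z (Submodule.mem_iSup_of_mem hz
      (Submodule.mul_mem_mul hg (Submodule.subset_span ⟨l, hl, rfl⟩)))
  have hone : (1 : A) ∈ M ^ D := by
    refine degreeLEOne_pow_mono (Nat.zero_le D) ?_
    rw [pow_zero]
    exact Submodule.one_le.1 le_rfl
  have hpow : ∀ z ∈ s, ∀ l ≤ (p z).natDegree, z ^ l ∈ W := fun z hz l hl => by
    simpa using hLW z hz l hl 1 hone
  have hfg : W.FG := by
    refine Submodule.fg_biSup s _ fun z _ => Submodule.FG.mul (Submodule.FG.pow ?_ D) ?_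
    · exact Submodule.fg_span ((Set.finite_range _).insert _)
    · exact Submodule.fg_span ((Set.finite_Iic _).image _)
  have hW : Algebra.adjoin K (W : Set A) = ⊤ := by
    rw [eq_top_iff, ← hs]
    refine Algebra.adjoin_mono fun z hz => ?_
    simpa using hpow z hz 1 (hdeg z)
  obtain ⟨δ, hc, hq, hδ⟩ := exists_completion_preservesIntersectionAtInfinity hfg hW
  -- the open set where no leading coefficient vanishes
  let lc : B := ∏ z ∈ s, (p z).leadingCoeff
  have hlc : lc ≠ 0 := Finset.prod_ne_zero_iff.2 fun z _ => Polynomial.leadingCoeff_ne_zero.2 (hp z)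
  obtain ⟨β, hβ⟩ : ∃ β : MvPolynomial (Fin r) K, MvPolynomial.aeval y β = lc := by
    have h1 : lc ∈ Algebra.adjoin K (Set.range y) := hy ▸ Algebra.mem_top
    rw [Algebra.adjoin_range_eq_range_aeval] at h1
    exact h1
  have hmem : ∀ x : A →ₐ[K] K, (fun i => x (φ (y i))) ∉
      MvPolynomial.zeroLocus K (Ideal.span {β}) ↔ x (φ lc) ≠ 0 := by
    intro x
    have h1 : MvPolynomial.aeval (fun i => x (φ (y i))) β = x (φ lc) := by
      rw [← hβ]
      exact (MvPolynomial.comp_aeval_apply y (x.comp φ) β).symm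
    rw [MvPolynomial.zeroLocus_span, ← h1]
    simp
  refine ⟨δ, hc, hq, Ideal.span {β}, ?_, ?_⟩
  · obtain ⟨x, hx⟩ := exists_algHom_apply_ne_zero (K := K)
      ((map_ne_zero_iff φ hinj).2 hlc)
    exact ⟨_, ⟨x, rfl⟩, (hmem x).2 hx⟩
  · rintro _ ⟨⟨x, rfl⟩, hx⟩
    have hx' := (hmem x).1 hx
    have hlevel : (fun i => levelSet (φ (y i)) (x (φ (y i)))) =
        fun i => (PrimeSpectrum.zeroLocus
          ((Ideal.span {φ (y i) - algebraMap K A (x (φ (y i)))} : Ideal A) : Set A) :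
            Set (Spec (CommRingCat.of A))) :=
      funext fun i => (PrimeSpectrum.zeroLocus_span _).symm
    rw [hlevel]
    refine hδ r _ fun V hVI hVpow => iSup₂_le fun z hz => ?_
    refine Submodule.mul_le.2 fun g hg w hw => ?_
    induction hw using Submodule.span_induction with
    | mem w hw =>
      obtain ⟨l, hl, rfl⟩ := hw
      refine mul_pow_mem_of_sum_eq_zero x (D := D) (k := (p z).natDegree)
        (b := fun l => φ ((p z).coeff l)) ?_ ?_ (hD z hz) ?_ ?_ hl hg
      · intro i n hn h hh l hl
        refine hVI i _ ?_ ?_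
        · have h1 : φ (y i) * h ∈ M ^ D := by
            refine degreeLEOne_pow_mono (Nat.succ_le_of_lt hn) ?_
            rw [Nat.succ_eq_add_one, pow_succ']
            exact Submodule.mul_mem_mul (apply_mem_degreeLEOne i) hh
          have h2 : (φ (y i) - algebraMap K A (x (φ (y i)))) * h ∈ M ^ D := by
            rw [sub_mul, ← Algebra.smul_def]
            exact sub_mem h1 (Submodule.smul_mem _ _ (degreeLEOne_pow_mono hn.le hh))
          exact hLW z hz l hl _ h2
        · rw [mul_assoc]
          exact Ideal.mul_mem_right _ _ (Ideal.mem_span_singleton_self _)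
      · exact fun l hl => hVpow z _ l hl (hpow z hz l hl.le) (hpow z hz _ le_rfl)
      · have h1 := hpz z
        rw [Polynomial.aeval_eq_sum_range] at h1
        simp only [Algebra.smul_def] at h1
        exact h1
      · intro h0
        refine hx' ?_
        rw [map_prod, map_prod]
        exact Finset.prod_eq_zero hz h0
    | zero =>
      rw [mul_zero]
      exact zero_mem V
    | add a b _ _ ha hb =>
      rw [mul_add]
      exact add_mem ha hb
    | smul c a _ ha =>
      rw [mul_smul_comm]
      exact V.smul_mem c ha

end MapAtInfinity

theorem mainTheorem3 {K : Type w} [Field K] [IsAlgClosed K]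
    {A : Type u} [CommRing A] [IsDomain A] [Algebra K A] [Algebra.FiniteType K A] :
    (∀ (m : ℕ) (V : Fin m → Set (Spec (CommRingCat.of A))),
      (∀ i, IsClosed (V i)) → (⋂ i, V i).Finite →
      ∃ δ : DegreeLike K A, δ.IsComplete ∧ δ.IsQuasidegree ∧
        IsOpenImmersion δ.completion ∧ IsDominant δ.completion ∧
        PreservesIntersectionAtInfinity δ.completion V) ∧
    (∀ (B : Type v) [CommRing B] [IsDomain B] [Algebra K B] (r : ℕ) (y : Fin r → B)
      (φ : B →ₐ[K] A),
      Algebra.adjoin K (Set.range y) = ⊤ →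
      DenseRange (PrimeSpectrum.comap φ.toRingHom) →
      ringKrullDim A = ringKrullDim B →
      ∃ δ : DegreeLike K A, δ.IsComplete ∧ δ.IsQuasidegree ∧
        IsOpenImmersion δ.completion ∧ IsDominant δ.completion ∧
        PreservesMapAtInfinity K δ.completion (fun i => φ (y i))) := by
  refine ⟨fun m V hV hfin => ?_, fun B _ _ _ r y φ hy hφ hdim => ?_⟩
  · obtain ⟨δ, hc, hq, hp⟩ := exists_completion_of_finite_iInter (K := K) V hV hfin
    exact ⟨δ, hc, hq, inferInstance, inferInstance, hp⟩
  · obtain ⟨δ, hc, hq, hp⟩ := exists_completion_preservesMapAtInfinity y φ hy hφ hdim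
    exact ⟨δ, hc, hq, inferInstance, inferInstance, hp⟩
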